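/- Let $L/K$ be a finite Galois extension of fields that are complete with respect to non-trivial discrete valuations and have finite residue fields (the valuation of $L$ extending that of $K$), with Galois group $G$. Write $\mathcal{O}_K,\mathcal{O}_L$ for the valuation rings, $\mathfrak{P}_L$ for the maximal ideal of $\mathcal{O}_L$, and, for $i\ge 0$, $G_i=\{\sigma\in G : (\sigma-1)(\mathcal{O}_L)\subseteq\mathfrak{P}_L^{i+1}\}$ for the ramification groups. Put $I=G_0$ and $W=G_1$. Suppose that $L/K$ is weakly ramified, i.e. $G_2=1$, and doubly split, i.e. there are a subgroup $C\le I$ and subgroups $U,T\le G$ with internal semi-direct product decompositions $$G=I\rtimes U,\qquad G=W\rtimes T,\qquad I=W\rtimes C,\qquad T=C\rtimes U,$$ and fix such $C,U,T$. Let $p>0$ be the residue characteristic of $K$, write $|W|=p^r$ and $c=|C|$, and let $S=WU$, which is a subgroup of $G$. For $H\le G$ let $L^H$ be the subfield of $L$ fixed by $H$. Let: - $n\in\mathbb{Z}$ with $n\equiv 1 \bmod |W|$; - $a,b\in\mathbb{Z}$ with $a p^r+b c=1$; - $\pi_T$ be any uniformizer of $L^T$; - $\pi_S$ be a uniformizer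 of $L^S$ such that $\pi_S^c$ is a uniformizer of $K$; - $u_0,\dots,u_{c-1}\in\mathcal{O}_K^\times$ and $\alpha=\sum_{i=0}^{c-1}u_i\pi_S^i$; - $\beta$ be a free generator of $\mathcal{O}_{L^I}$ over $\mathcal{O}_K[\mathrm{Gal}(L^I/K)]$ (a normal integral basis generator of the unramified extension $L^I/K$). Then $\varepsilon=\pi_T^{nb}\,\pi_S^{na}\,\alpha\,\beta$ is a free generator of the fractional ideal $\mathfrak{P}_L^n$ over the group ring $\mathcal{O}_K[G]$; that is, the map $\mathcal{O}_K[G]\to L$, $x\mapsto x\cdot\varepsilon$, is injective with image $\mathfrak{P}_L^n$. -/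

import Mathlib

open scoped ValuativeRel nonZeroDivisors

namespace WeakRam

section Groups

/-- `H = N ⋊ Q` as an internal semi-direct product: `N` and `Q` are subgroups of `H`,
`N` is normal in `H`, `N ∩ Q = 1` and `N Q = H`. -/
structure IsSemidirect {G : Type*} [Group G] (H N Q : Subgroup G) : Prop where
  left_le : N ≤ H
  right_le : Q ≤ H
  normal : (N.subgroupOf H).Normal
  disjoint : N ⊓ Q = ⊥
  mul_eq : ∀ g ∈ H, ∃ x ∈ N, ∃ y ∈ Q, x * y = g

end Groups

section Uniformizers

/-- `π` is a uniformizer of the field `E` with discrete valuation ring `O`, that is,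
a prime element of `O`. -/
def IsUniformizer {E : Type*} [Field E] (O : Subring E) (π : E) : Prop :=
  ∃ ϖ : O, Irreducible ϖ ∧ (ϖ : E) = π

end Uniformizers

section Ramification

variable (K L : Type*) [Field K] [Field L] [ValuativeRel L] [Algebra K L]

/-- The valuation ring `𝒪_F = F ∩ 𝒪_L` of an intermediate field `F` of `L/K`. -/
noncomputable def integers {K L : Type*} [Field K] [Field L] [ValuativeRel L] [Algebra K L]
    (F : IntermediateField K L) : Subring F :=
  (𝒪[L]).comap (algebraMap F L)

/-- The fractional ideal `𝔓_L ^ n` of `𝒪_L` for `n : ℤ`, as a subset of `L`. -/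
noncomputable def primePow (L : Type*) [Field L] [ValuativeRel L] [IsDiscreteValuationRing 𝒪[L]]
    (n : ℤ) : Set L :=
  {x | x ∈ ((𝓂[L] : Ideal 𝒪[L]) : FractionalIdeal 𝒪[L]⁰ L) ^ n}

/-- The condition `(σ - 1)(𝒪_L) ⊆ 𝔓_L ^ (i + 1)`. -/
def ActsTrivially (i : ℕ) (σ : Gal(L/K)) : Prop :=
  ∀ x : 𝒪[L], ∃ y ∈ (𝓂[L] : Ideal 𝒪[L]) ^ (i + 1), (y : L) = σ x - x

variable {K L} in
theorem ActsTrivially.mul {i : ℕ} {σ τ : Gal(L/K)} (hσ : ActsTrivially K L i σ)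
    (hτ : ActsTrivially K L i τ) : ActsTrivially K L i (σ * τ) := by
  intro x
  obtain ⟨y, hy, hyx⟩ := hτ x
  obtain ⟨z, hz, hzx⟩ := hσ (x + y)
  refine ⟨z + y, Ideal.add_mem _ hz hy, ?_⟩
  have h1 : τ x = ((x + y : 𝒪[L]) : L) := by push_cast; rw [hyx]; ring
  rw [AlgEquiv.mul_apply, h1]
  push_cast at hzx ⊢
  rw [hzx]
  ring

theorem ActsTrivially.one (i : ℕ) : ActsTrivially K L i 1 :=
  fun x => ⟨0, Ideal.zero_mem _, by simp⟩

/-- The ramification group `G_i = {σ ∈ Gal(L/K) | (σ - 1)(𝒪_L) ⊆ 𝔓_L ^ (i + 1)}`, `i ≥ 0`,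
in the lower numbering, of a finite extension `L/K`. -/
def ramificationGroup [FiniteDimensional K L] (i : ℕ) : Subgroup Gal(L/K) where
  carrier := {σ | ActsTrivially K L i σ}
  mul_mem' := ActsTrivially.mul
  one_mem' := ActsTrivially.one K L i
  inv_mem' := by
    intro σ hσ
    have hpow : ∀ m : ℕ, ActsTrivially K L i (σ ^ m) := by
      intro m
      induction m with
      | zero => simpa using ActsTrivially.one K L i
      | succ m ih => rw [pow_succ]; exact ih.mul hσ
    obtain ⟨m, hm⟩ := (mem_powers_iff_mem_zpowers (x := σ) (y := σ⁻¹)).2 ⟨-1, by simp⟩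
    simp only [Set.mem_ofPred_eq]
    rw [← hm]
    exact hpow m

/-- `L/K` is weakly ramified: its second ramification group is trivial. -/
def IsWeaklyRamified [FiniteDimensional K L] : Prop :=
  ramificationGroup K L 2 = ⊥

/-- The subgroups `C, U, T` exhibit `L/K` as doubly split: with `I = G_0` and `W = G_1`,
`G = I ⋊ U`, `G = W ⋊ T`, `I = W ⋊ C` and `T = C ⋊ U`. -/
structure IsDoublySplit [FiniteDimensional K L] (C U T : Subgroup Gal(L/K)) : Prop where
  inertia : IsSemidirect ⊤ (ramificationGroup K L 0) U
  wild : IsSemidirect ⊤ (ramificationGroup K L 1) T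
  tame : IsSemidirect (ramificationGroup K L 0) (ramificationGroup K L 1) C
  complement : IsSemidirect T C U

end Ramification

section FreeGenerators

variable (K E : Type*) [Field K] [ValuativeRel K] [Field E] [Algebra K E]

/-- The natural `𝒪_K`-linear action of `Gal(E/K)` on `E`. -/
noncomputable def galRep : Representation 𝒪[K] Gal(E/K) E where
  toFun σ := σ.toLinearMap.restrictScalars 𝒪[K]
  map_one' := rfl
  map_mul' _ _ := rfl

variable {E} in
/-- `ε` is a free generator of `Λ ⊆ E` over the group ring `𝒪_K[Gal(E/K)]`: the map
`𝒪_K[Gal(E/K)] → E`, `r ↦ r · ε`, is injective with image `Λ`. -/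
def IsFreeGenerator (Λ : Set E) (ε : E) : Prop :=
  Function.Injective (fun r : MonoidAlgebra 𝒪[K] Gal(E/K) => (galRep K E).asAlgebraHom r ε) ∧
    Set.range (fun r : MonoidAlgebra 𝒪[K] Gal(E/K) => (galRep K E).asAlgebraHom r ε) = Λ

end FreeGenerators

end WeakRam

set_option linter.unusedSectionVars false

/-! Write q = |W|, c = |C|, and N for the 𝒪_K-span of the conjugates of ε; `val L x = exp (-k)`
means that x has order k. The splitting forces π_S to have order q and π_T order c
(`val_uniformizers`), so a q + b c = 1 puts ε in 𝔓_L^n, and N ⊆ 𝔓_L^n. The substance is the reverse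
inclusion: it makes the [L : K] conjugates of ε span L over K, so injectivity is a dimension count.

By Nakayama (`mem_of_forall_exists_val_sub_le`) it suffices to approximate 𝔓_L^n by N modulo π_K
𝔓_L^n = 𝔓_L^(n + c q). This takes c layers of depth q, and each factor of ε serves one component of
G. For U: the conjugates of β span 𝒪_{L^I}, so N absorbs coefficients from that ring
(`mem_span_of_isFreeGenerator`). For C: it acts on π_S through a faithful character with values in
L^I (`exists_tameCharacter`), and orthogonality isolates each term u_i π_S^(n a + i) of π_S^(n a) α,
since c and the u_i are units (`sum_char_mul_apply`). For W: up to a power of π_S, the factor π_T^(n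
b) becomes an element x₀ of order 1 - q, whose W-conjugates generate 𝔓_L^(1-q) modulo 𝔓_L with
coefficients from 𝒪_{L^I} (`exists_val_sub_sum_lt_one`).

The last point uses weak ramification. The different of L/L^W has order 2(q - 1), so by Euler's
formula the W-trace of x₀ is a unit (`val_sum_wild_eq_one`). If the conjugates satisfied a
nontrivial relation modulo 𝔓_L, the p-group W acting on the relations would fix a nonzero one, that
is, one with constant coefficients, contradicting the unit trace. Independence then gives generation
by counting. -/

namespace WeakRam

open WithZero IsNonarchimedeanLocalField

/-! ### The normalized valuation and the powers of the maximal ideal. -/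

section NormalizedValuation

variable (L : Type*) [Field L] [ValuativeRel L] [TopologicalSpace L]
  [IsNonarchimedeanLocalField L]

/-- The normalized valuation of a local field, with values in `ℤᵐ⁰`. -/
noncomputable def val : Valuation L (WithZero (Multiplicative ℤ)) :=
  (ValuativeRel.valuation L).map
    (MonoidWithZeroHom.mk ⟨valueGroupWithZeroIsoInt L, map_zero _⟩ (map_one _) (map_mul _))
    (valueGroupWithZeroIsoInt L).strictMono.monotone

variable {L}

theorem val_le_one_iff {x : L} : val L x ≤ 1 ↔ x ∈ 𝒪[L] := by
  rw [Valuation.mem_integer_iff]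
  have : val L x = valueGroupWithZeroIsoInt L (ValuativeRel.valuation L x) := rfl
  rw [this, ← map_one (valueGroupWithZeroIsoInt L)]
  exact (valueGroupWithZeroIsoInt L).strictMono.le_iff_le

theorem val_coe_le_one (x : 𝒪[L]) : val L x ≤ 1 := val_le_one_iff.2 x.2

theorem val_natCast_le_one (m : ℕ) : val L (m : L) ≤ 1 := by
  have := val_coe_le_one (m : 𝒪[L])
  rwa [Subring.coe_natCast] at this

theorem val_lt_one_iff {x : 𝒪[L]} : val L x < 1 ↔ x ∈ 𝓂[L] := by
  rw [IsLocalRing.mem_maximalIdeal, mem_nonunits_iff, ← not_le, not_iff_not]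
  constructor
  · intro h
    have hx : (x : L) ≠ 0 := by rintro h0; simp [h0] at h
    have hi : (x : L)⁻¹ ∈ 𝒪[L] := by
      rw [← val_le_one_iff, map_inv₀]
      exact inv_le_one_of_one_le₀ h
    exact .of_mul_eq_one ⟨_, hi⟩ (Subtype.ext (mul_inv_cancel₀ hx))
  · rintro ⟨u, rfl⟩
    have h1 : val L ((u : 𝒪[L]) : L) * val L (((u⁻¹ : 𝒪[L]ˣ) : 𝒪[L]) : L) = 1 := by
      rw [← map_mul, ← Subring.coe_mul, Units.mul_inv]; simp
    by_contra h
    have := mul_lt_mul'' (not_le.1 h) (lt_of_le_of_ne (val_coe_le_one ((u⁻¹ : 𝒪[L]ˣ) : 𝒪[L])) ?_) zero_le zero_le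
    · simp [h1] at this
    · intro h2
      rw [h2, mul_one] at h1
      exact h h1.ge

variable (L) in
theorem val_surjective : Function.Surjective (val L) := fun γ => by
  obtain ⟨x, hx⟩ := ValuativeRel.valuation_surjective ((valueGroupWithZeroIsoInt L).symm γ)
  exact ⟨x, by
    have : val L x = valueGroupWithZeroIsoInt L (ValuativeRel.valuation L x) := rfl
    simp [this, hx]⟩

variable (L) in
theorem exists_val_eq_exp_neg_one : ∃ π : L, val L π = exp (-1) := val_surjective L _

theorem exists_val_eq_exp {x : L} (hx : x ≠ 0) : ∃ k : ℤ, val L x = exp k :=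
  ⟨_, (exp_log ((val L).ne_zero_iff.2 hx)).symm⟩

theorem lt_one_iff_le_exp {γ : WithZero (Multiplicative ℤ)} : γ < 1 ↔ γ ≤ exp (-1 : ℤ) := by
  induction γ using expRecOn with
  | zero => simp
  | exp a =>
    rw [← exp_zero, exp_lt_exp, exp_le_exp]
    lia

theorem lt_exp_iff_le_exp {γ : WithZero (Multiplicative ℤ)} {k : ℤ} :
    γ < exp k ↔ γ ≤ exp (k - 1) := by
  induction γ using expRecOn with
  | zero => simp
  | exp a =>
    rw [exp_lt_exp, exp_le_exp]
    lia

theorem val_zpow_of_eq {π : L} {m : ℤ} (hπ : val L π = exp m) (k : ℤ) :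
    val L (π ^ k) = exp (k * m) := by
  rw [map_zpow₀, hπ, ← exp_zsmul, smul_eq_mul]

theorem val_pow_of_eq {π : L} {m : ℤ} (hπ : val L π = exp m) (k : ℕ) :
    val L (π ^ k) = exp (k * m) := by
  rw [map_pow, hπ, ← exp_nsmul, nsmul_eq_mul]

theorem ne_zero_of_val_eq {x : L} {m : ℤ} (h : val L x = exp m) : x ≠ 0 :=
  (val L).ne_zero_iff.1 (by simp [h])

theorem val_mul_zpow_le_iff {π : L} {m : ℤ} (hπ : val L π = exp m) {x : L} {j k : ℤ} :
    val L (x * π ^ k) ≤ exp j ↔ val L x ≤ exp (j - k * m) := by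
  rw [map_mul, val_zpow_of_eq hπ, exp_sub, le_div_iff₀ exp_pos]

theorem mem_maximalIdeal_pow_iff {x : 𝒪[L]} {n : ℕ} :
    x ∈ 𝓂[L] ^ n ↔ val L x ≤ exp (-(n : ℤ)) := by
  obtain ⟨π, hπ⟩ := exists_val_eq_exp_neg_one L
  have hπO : π ∈ 𝒪[L] := val_le_one_iff.1 (by rw [hπ, ← exp_zero, exp_le_exp]; lia)
  have hπ0 : π ≠ 0 := ne_zero_of_val_eq hπ
  have hspan : 𝓂[L] = Ideal.span {⟨π, hπO⟩} := by
    ext y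
    rw [← val_lt_one_iff, lt_one_iff_le_exp, Ideal.mem_span_singleton']
    constructor
    · intro h
      refine ⟨⟨y * π ^ (-1 : ℤ), val_le_one_iff.1 ?_⟩, Subtype.ext ?_⟩
      · rw [← exp_zero, val_mul_zpow_le_iff hπ]; simpa using h
      · simp [hπ0]
    · rintro ⟨a, rfl⟩
      rw [Subring.coe_mul, map_mul, hπ]
      exact mul_le_of_le_one_left' (val_coe_le_one a)
  rw [hspan, Ideal.span_singleton_pow, Ideal.mem_span_singleton']
  constructor
  · rintro ⟨a, rfl⟩
    rw [Subring.coe_mul, map_mul, Subring.coe_pow, val_pow_of_eq hπ, mul_neg, mul_one]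
    exact mul_le_of_le_one_left' (val_coe_le_one a)
  · intro h
    refine ⟨⟨x * π ^ (-(n : ℤ)), val_le_one_iff.1 ?_⟩, Subtype.ext ?_⟩
    · rw [← exp_zero, val_mul_zpow_le_iff hπ]; simpa using h
    · simp [hπ0]

theorem mem_primePow_iff {n : ℤ} {x : L} : x ∈ primePow L n ↔ val L x ≤ exp (-n) := by
  obtain ⟨π, hπ⟩ := exists_val_eq_exp_neg_one L
  have hπO : π ∈ 𝒪[L] := val_le_one_iff.1 (by rw [hπ, ← exp_zero, exp_le_exp]; lia)
  have hπ0 : π ≠ 0 := ne_zero_of_val_eq hπ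
  have hspan : 𝓂[L] = Ideal.span {⟨π, hπO⟩} := by
    ext y
    rw [← pow_one 𝓂[L], mem_maximalIdeal_pow_iff, Ideal.mem_span_singleton']
    constructor
    · intro h
      refine ⟨⟨y * π ^ (-1 : ℤ), val_le_one_iff.1 ?_⟩, Subtype.ext ?_⟩
      · rw [← exp_zero, val_mul_zpow_le_iff hπ]; simpa using h
      · simp [hπ0]
    · rintro ⟨a, rfl⟩
      rw [Subring.coe_mul, map_mul, hπ]
      exact mul_le_of_le_one_left' (val_coe_le_one a)
  have hpow : ((𝓂[L] : Ideal 𝒪[L]) : FractionalIdeal 𝒪[L]⁰ L) ^ n =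
      FractionalIdeal.spanSingleton 𝒪[L]⁰ (π ^ n) := by
    rw [hspan, FractionalIdeal.coeIdeal_span_singleton]
    cases n with
    | ofNat n => simp [FractionalIdeal.spanSingleton_pow]; rfl
    | negSucc n =>
      rw [zpow_negSucc, zpow_negSucc, FractionalIdeal.spanSingleton_pow,
        FractionalIdeal.spanSingleton_inv]; rfl
  change x ∈ ((𝓂[L] : Ideal 𝒪[L]) : FractionalIdeal 𝒪[L]⁰ L) ^ n ↔ _
  rw [hpow, FractionalIdeal.mem_spanSingleton]
  constructor
  · rintro ⟨a, rfl⟩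
    rw [Subring.smul_def, smul_eq_mul, map_mul, val_zpow_of_eq hπ, mul_neg, mul_one]
    exact mul_le_of_le_one_left' (val_coe_le_one a)
  · intro h
    refine ⟨⟨x * π ^ (-n), val_le_one_iff.1 ?_⟩, ?_⟩
    · rw [← exp_zero, val_mul_zpow_le_iff hπ]; simpa using h
    · simp [Subring.smul_def, zpow_ne_zero n hπ0]

/-- If `R` is the preimage of the valuation ring under `f : E → L`, then a uniformizer of `R` has
the largest valuation below one among the elements of `E`. -/
theorem IsUniformizer.val_le {E : Type*} [Field E] {R : Subring E} {ϖ : E}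
    (h : IsUniformizer R ϖ) (f : E →+* L) (hf : ∀ x, x ∈ R ↔ val L (f x) ≤ 1) {z : E}
    (hz : val L (f z) < 1) : val L (f z) ≤ val L (f ϖ) := by
  obtain ⟨ϖ, hirr, rfl⟩ := h
  by_contra! hlt
  have hz0 : z ≠ 0 := by rintro rfl; simp at hlt
  have hz' : z ∈ R := (hf z).2 hz.le
  have hw : (ϖ : E) / z ∈ R := by
    rw [hf, map_div₀, map_div₀]
    exact div_le_one_of_le₀ hlt.le zero_le
  rcases hirr.isUnit_or_isUnit (a := ⟨z, hz'⟩) (b := ⟨_, hw⟩)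
    (Subtype.ext (mul_div_cancel₀ _ hz0).symm) with hu | hu
  · obtain ⟨t, ht⟩ := hu.exists_right_inv
    have := congrArg (fun y : R => val L (f y)) ht
    simp only [Subring.coe_mul, map_mul, Subring.coe_one, map_one] at this
    exact absurd this (mul_lt_one_of_lt_of_le hz ((hf _).1 t.2)).ne
  · obtain ⟨t, ht⟩ := hu.exists_right_inv
    have := congrArg (fun y : R => val L (f y)) ht
    simp only [Subring.coe_mul, map_mul, Subring.coe_one, map_one] at this
    refine absurd this (mul_lt_one_of_lt_of_le ?_ ((hf _).1 t.2)).ne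
    rw [map_div₀, map_div₀]
    exact (div_lt_one₀ (zero_le.trans_lt hlt)).2 hlt

theorem IsUniformizer.val_lt_one {E : Type*} [Field E] {R : Subring E} {ϖ : E}
    (h : IsUniformizer R ϖ) (f : E →+* L) (hf : ∀ x, x ∈ R ↔ val L (f x) ≤ 1) :
    val L (f ϖ) < 1 := by
  obtain ⟨ϖ, hirr, rfl⟩ := h
  refine lt_of_le_of_ne ((hf _).1 ϖ.2) fun h1 => hirr.not_isUnit ?_
  have h0 : (ϖ : E) ≠ 0 := by rintro h0; simp [h0] at h1
  have : (ϖ : E)⁻¹ ∈ R := by rw [hf, map_inv₀, map_inv₀, h1, inv_one]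
  exact .of_mul_eq_one ⟨_, this⟩ (Subtype.ext (mul_inv_cancel₀ h0))

theorem IsUniformizer.ne_zero {E : Type*} [Field E] {R : Subring E} {ϖ : E}
    (h : IsUniformizer R ϖ) : ϖ ≠ 0 := by
  obtain ⟨ϖ, hirr, rfl⟩ := h
  exact fun h => hirr.ne_zero (Subtype.ext h)

end NormalizedValuation

/-! ### Hensel's lemma: roots of one-units and Teichmüller representatives. -/

section Henselian

variable {L : Type*} [Field L] [ValuativeRel L] [TopologicalSpace L]
  [IsNonarchimedeanLocalField L]

variable (L) in
theorem henselianRing_integer : HenselianRing 𝒪[L] 𝓂[L] := by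
  let := IsTopologicalAddGroup.rightUniformSpace L
  have := isUniformAddGroup_of_addCommGroup (G := L)
  infer_instance

open Polynomial in
/-- One-units have `N`-th roots for every `N` prime to the residue characteristic. -/
theorem exists_pow_eq_of_val_sub_one_lt {x : L} (hx : val L x < 1) {N : ℕ}
    (hN : val L (N : L) = 1) : ∃ y : L, y ^ N = 1 + x := by
  have := henselianRing_integer L
  have hN0 : N ≠ 0 := by rintro rfl; simp at hN
  let a : 𝒪[L] := ⟨1 + x, add_mem (one_mem _) (val_le_one_iff.1 hx.le)⟩
  obtain ⟨y, hy, -⟩ := HenselianRing.is_henselian (I := 𝓂[L]) (X ^ N - C a)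
    (monic_X_pow_sub_C _ hN0) 1 (by rw [← val_lt_one_iff]; simpa [a] using hx) (by
      refine IsUnit.map _ ?_
      rw [← not_not (a := IsUnit _), ← mem_nonunits_iff, ← IsLocalRing.mem_maximalIdeal,
        ← val_lt_one_iff]
      simp [derivative_X_pow, hN])
  refine ⟨y, ?_⟩
  have := congrArg (Subtype.val) hy
  simpa [sub_eq_zero, a] using this

theorem val_sub_pow_card_lt_one {x : L} (hx : val L x ≤ 1) :
    val L (x ^ Nat.card 𝓀[L] - x) < 1 := by
  have := Fintype.ofFinite 𝓀[L]
  let y : 𝒪[L] := ⟨x, val_le_one_iff.1 hx⟩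
  have : y ^ Nat.card 𝓀[L] - y ∈ 𝓂[L] := by
    rw [← IsLocalRing.residue_eq_zero_iff]
    simp [FiniteField.pow_card, Nat.card_eq_fintype_card]
  exact val_lt_one_iff.2 this

variable (L) in
theorem val_card_residueField_lt_one : val L (Nat.card 𝓀[L] : L) < 1 := by
  have := Fintype.ofFinite 𝓀[L]
  have : (Nat.card 𝓀[L] : 𝒪[L]) ∈ 𝓂[L] := by
    rw [← IsLocalRing.residue_eq_zero_iff]
    simp [Nat.card_eq_fintype_card]
  simpa using val_lt_one_iff.2 this

open Polynomial in
/-- Teichmüller representatives. -/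
theorem exists_pow_card_eq_self {x : L} (hx : val L x ≤ 1) :
    ∃ y : L, val L y ≤ 1 ∧ val L (y - x) < 1 ∧ y ^ Nat.card 𝓀[L] = y := by
  have := henselianRing_integer L
  have h1 : 1 < Nat.card 𝓀[L] := Finite.one_lt_card
  obtain ⟨y, hy, hyx⟩ := HenselianRing.is_henselian (I := 𝓂[L]) (X ^ Nat.card 𝓀[L] - X)
    (monic_X_pow_sub (by rw [degree_X]; exact_mod_cast h1)) ⟨x, val_le_one_iff.1 hx⟩
    (by rw [← val_lt_one_iff]; simpa using val_sub_pow_card_lt_one hx) (by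
      refine IsUnit.map _ ?_
      rw [← not_not (a := IsUnit _), ← mem_nonunits_iff, ← IsLocalRing.mem_maximalIdeal,
        ← val_lt_one_iff, not_lt]
      set z := ((eval (⟨x, val_le_one_iff.1 hx⟩ : 𝒪[L])
        (derivative (X ^ Nat.card 𝓀[L] - X)) : 𝒪[L]) : L) with hz
      -- The derivative reduces to -1, because the cardinality of the residue field vanishes in it.
      have hz' : z + 1 = (Nat.card 𝓀[L] : L) * x ^ (Nat.card 𝓀[L] - 1) := by simp [hz, derivative_X_pow]
      have hlt : val L (z + 1) < 1 := by
        rw [hz', map_mul]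
        refine mul_lt_one_of_lt_of_le (val_card_residueField_lt_one L) ?_
        rw [map_pow]
        exact pow_le_one₀ zero_le hx
      by_contra! hz1
      have := (val L).map_sub_lt hlt hz1
      simp at this)
  refine ⟨y, val_coe_le_one y, by simpa using val_lt_one_iff.2 hyx, ?_⟩
  have := congrArg (Subtype.val) hy
  simpa [sub_eq_zero] using this

/-- With Q the residue cardinality, y ^ Q - x ^ Q = y - x. If y ≠ x, the cofactor ∑ y ^ i x ^ (Q - 1
- i) is 1, but it reduces to Q x ^ (Q - 1) = 0. -/
theorem eq_of_pow_card_eq_self {x y : L} (hx : val L x ≤ 1) (hy : val L y ≤ 1)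
    (hxc : x ^ Nat.card 𝓀[L] = x) (hyc : y ^ Nat.card 𝓀[L] = y) (h : val L (y - x) < 1) :
    y = x := by
  have := Fintype.ofFinite 𝓀[L]
  lift x to 𝒪[L] using val_le_one_iff.1 hx
  lift y to 𝒪[L] using val_le_one_iff.1 hy
  have hxc' : x ^ Nat.card 𝓀[L] = x := Subtype.ext (by simpa using hxc)
  have hyc' : y ^ Nat.card 𝓀[L] = y := Subtype.ext (by simpa using hyc)
  have hres : IsLocalRing.residue 𝒪[L] y = IsLocalRing.residue 𝒪[L] x := by
    rw [← sub_eq_zero, ← map_sub, IsLocalRing.residue_eq_zero_iff, ← val_lt_one_iff]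
    simpa using h
  have key := geom_sum₂_mul y x (Nat.card 𝓀[L])
  rw [hxc', hyc'] at key
  by_contra hne
  have hne' : y - x ≠ 0 := sub_ne_zero.2 fun h => hne (by rw [h])
  have h1 := congrArg (IsLocalRing.residue 𝒪[L]) (mul_right_cancel₀ hne' (key.trans (one_mul _).symm))
  simp [map_sum, hres, geom_sum₂_self, Nat.card_eq_fintype_card] at h1

end Henselian

end WeakRam

namespace WeakRam

open WithZero IsNonarchimedeanLocalField

/-! ### Automatic invariance of the valuation under field automorphisms. -/

section GaloisInvariance

variable {L : Type*} [Field L] [ValuativeRel L] [TopologicalSpace L]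
  [IsNonarchimedeanLocalField L]

/-- Continuity of σ is not assumed. Being an N-th power is algebraic, hence preserved by σ, and 1 +
x is an N-th power for every N prime to the residue characteristic; a pole of 1 + σ x would have
order divisible by all such N. -/
theorem val_map_le_one_of_lt (σ : L ≃+* L) {x : L} (hx : val L x < 1) : val L (σ x) ≤ 1 := by
  by_contra! hσ
  have h1 : val L (1 + σ x) = val L (σ x) :=
    (val L).map_add_eq_of_lt_right (x := 1) (y := σ x) (by simpa using hσ)
  have h0 : σ x ≠ 0 := by intro h; simp [h] at hσ
  obtain ⟨k, hk⟩ := exists_val_eq_exp h0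
  have hk0 : 0 < k := by rwa [hk, ← exp_zero, exp_lt_exp] at hσ
  set Q := Nat.card 𝓀[L]
  have hQ : 0 < Q := Nat.card_pos
  -- The exponent Q k + 1 is prime to the residue characteristic and larger than the pole order k,
  -- so it cannot divide k.
  have hN : val L ((Q * k.toNat + 1 : ℕ) : L) = 1 := by
    push_cast
    rw [add_comm]
    apply (val L).map_one_add_of_lt
    rw [map_mul]
    exact mul_lt_one_of_lt_of_le (val_card_residueField_lt_one L) (val_natCast_le_one _)
  obtain ⟨y, hy⟩ := exists_pow_eq_of_val_sub_one_lt hx hN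
  have hy' : σ y ^ (Q * k.toNat + 1) = 1 + σ x := by rw [← map_pow, hy]; simp
  have hy0 : σ y ≠ 0 := by
    intro h
    rw [h, zero_pow (by lia)] at hy'
    rw [← hy', hk, map_zero] at h1
    exact exp_ne_zero h1.symm
  obtain ⟨j, hj⟩ := exists_val_eq_exp hy0
  have := val_pow_of_eq hj (Q * k.toNat + 1)
  rw [hy', h1, hk, exp_inj] at this
  have hdvd : ((Q * k.toNat + 1 : ℕ) : ℤ) ∣ k := ⟨j, this⟩
  have hle := Int.le_of_dvd hk0 hdvd
  push_cast at hle
  rw [Int.toNat_of_nonneg hk0.le] at hle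
  nlinarith

theorem val_map_le_one (σ : L ≃+* L) {x : L} (hx : val L x ≤ 1) : val L (σ x) ≤ 1 := by
  by_contra! hσ
  obtain ⟨π, hπ⟩ := exists_val_eq_exp_neg_one L
  obtain ⟨k, hk⟩ := exists_val_eq_exp (x := σ x) (by intro h; simp [h] at hσ)
  have hk0 : 0 < k := by rwa [hk, ← exp_zero, exp_lt_exp] at hσ
  obtain ⟨m, hm⟩ := exists_val_eq_exp (x := σ π) (by simpa using ne_zero_of_val_eq hπ)
  -- The factor π makes the previous case apply; the exponent |m| + 1 lets the pole of σ x outweigh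
  -- the order -m of σ π.
  have h1 : val L (π * x ^ (m.natAbs + 1)) < 1 := by
    rw [map_mul, map_pow]
    refine mul_lt_one_of_lt_of_le ?_ (pow_le_one₀ zero_le hx)
    rw [hπ, ← exp_zero, exp_lt_exp]
    lia
  have h2 := val_map_le_one_of_lt σ h1
  rw [map_mul, map_pow, map_mul, val_pow_of_eq hk, hm, ← exp_add, ← exp_zero, exp_le_exp] at h2
  push_cast at h2
  have : -m ≤ |m| := neg_le_abs m
  nlinarith [abs_nonneg m]

/-- The valuation of a local field is invariant under field automorphisms. -/
theorem val_map (σ : L ≃+* L) (x : L) : val L (σ x) = val L x := by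
  obtain ⟨π, hπ⟩ := exists_val_eq_exp_neg_one L
  have hπ0 := ne_zero_of_val_eq hπ
  have hunit (τ : L ≃+* L) {u : L} (hu : val L u = 1) : val L (τ u) = 1 := by
    refine le_antisymm (val_map_le_one τ hu.le) ?_
    have := val_map_le_one τ (x := u⁻¹) (by simp [hu])
    rw [map_inv₀, map_inv₀] at this
    have h0 : u ≠ 0 := by rintro rfl; simp at hu
    exact (inv_le_one₀ (by simpa [zero_lt_iff] using h0)).1 this
  have hlt (τ : L ≃+* L) : val L (τ π) ≤ exp (-1) := by
    rw [← lt_one_iff_le_exp]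
    have h1 : val L π < 1 := by rw [hπ, ← exp_zero, exp_lt_exp]; lia
    refine lt_of_le_of_ne (val_map_le_one τ h1.le) fun h => ?_
    have := hunit τ.symm h
    simp [hπ] at this
  have hσπ : val L (σ π) = exp (-1) := by
    refine le_antisymm (hlt σ) ?_
    have h1 : val L (σ.symm π * π ^ (-1 : ℤ)) ≤ 1 := by
      rw [← exp_zero, val_mul_zpow_le_iff hπ]
      simpa using hlt σ.symm
    have h2 := val_map_le_one σ h1
    rw [map_mul, σ.apply_symm_apply, map_zpow₀, map_mul, map_zpow₀, zpow_neg_one, hπ] at h2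
    have h3 : val L (σ π) ≠ 0 := by simpa using hπ0
    rwa [← div_eq_mul_inv, div_le_one₀ (zero_lt_iff.2 h3)] at h2
  rcases eq_or_ne x 0 with rfl | hx
  · simp
  obtain ⟨k, hk⟩ := exists_val_eq_exp hx
  have hu : val L (x * π ^ k) = 1 := by
    rw [map_mul, val_zpow_of_eq hπ, hk, ← exp_add, ← exp_zero]
    congr 1; ring
  have h1 := hunit σ hu
  rw [map_mul, map_zpow₀, map_mul, val_zpow_of_eq hσπ] at h1
  rw [map_mul, val_zpow_of_eq hπ] at hu
  exact mul_right_cancel₀ exp_ne_zero (h1.trans hu.symm)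

end GaloisInvariance

/-! ### Ramification groups in terms of the valuation. -/

section Extension

variable {K L : Type*} [Field K] [Field L] [ValuativeRel L] [TopologicalSpace L]
  [IsNonarchimedeanLocalField L] [Algebra K L]

theorem val_algebraMap_le_one_iff [ValuativeRel K] [ValuativeExtension K L] {x : K} :
    val L (algebraMap K L x) ≤ 1 ↔ x ∈ 𝒪[K] := by
  rw [val_le_one_iff, Valuation.mem_integer_iff, Valuation.mem_integer_iff,
    ← map_one (ValuativeRel.valuation L), ← map_one (ValuativeRel.valuation K),
    ← Valuation.Compatible.vle_iff_le, ← Valuation.Compatible.vle_iff_le,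
    ← ValuativeExtension.vle_iff_vle (A := K) (B := L), map_one]

theorem val_algEquiv (σ : Gal(L/K)) (x : L) : val L (σ x) = val L x :=
  val_map (σ : L ≃+* L) x

theorem val_algebraMap_unit [ValuativeRel K] [ValuativeExtension K L] (u : 𝒪[K]ˣ) :
    val L (algebraMap K L (u : 𝒪[K])) = 1 := by
  have h1 := val_algebraMap_le_one_iff (L := L).2 (u : 𝒪[K]).2
  have h2 := val_algebraMap_le_one_iff (L := L).2 ((u⁻¹ : 𝒪[K]ˣ) : 𝒪[K]).2
  have h3 : val L (algebraMap K L (u : 𝒪[K])) *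
      val L (algebraMap K L ((u⁻¹ : 𝒪[K]ˣ) : 𝒪[K])) = 1 := by
    rw [← map_mul, ← map_mul, ← Subring.coe_mul, Units.mul_inv]; simp
  refine le_antisymm h1 ?_
  rw [← h3]
  exact mul_le_of_le_one_right' h2

theorem mem_integers_iff (F : IntermediateField K L) (x : F) :
    x ∈ integers F ↔ val L (algebraMap F L x) ≤ 1 := by
  rw [val_le_one_iff]; rfl

theorem actsTrivially_iff {i : ℕ} {σ : Gal(L/K)} :
    ActsTrivially K L i σ ↔ ∀ x, val L x ≤ 1 → val L (σ x - x) ≤ exp (-(i + 1 : ℤ)) := by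
  constructor
  · intro h x hx
    obtain ⟨y, hy, hyx⟩ := h ⟨x, val_le_one_iff.1 hx⟩
    rw [mem_maximalIdeal_pow_iff] at hy
    rw [hyx] at hy
    simpa using hy
  · intro h x
    have hx := h x (val_coe_le_one x)
    have hO : σ x - x ∈ 𝒪[L] := by
      rw [← val_le_one_iff]
      refine hx.trans ?_
      rw [← exp_zero, exp_le_exp]; lia
    exact ⟨⟨_, hO⟩, mem_maximalIdeal_pow_iff.2 (by simpa using hx), rfl⟩

variable [FiniteDimensional K L]

theorem mem_ramificationGroup_iff {i : ℕ} {σ : Gal(L/K)} :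
    σ ∈ ramificationGroup K L i ↔
      ∀ x, val L x ≤ 1 → val L (σ x - x) ≤ exp (-(i + 1 : ℤ)) :=
  actsTrivially_iff

theorem ramificationGroup_anti {i j : ℕ} (hij : i ≤ j) :
    ramificationGroup K L j ≤ ramificationGroup K L i := by
  intro σ hσ
  rw [mem_ramificationGroup_iff] at hσ ⊢
  refine fun x hx => (hσ x hx).trans ?_
  rw [exp_le_exp]; lia

theorem val_sub_lt_one_of_mem_inertia {σ : Gal(L/K)} (hσ : σ ∈ ramificationGroup K L 0) {x : L}
    (hx : val L x ≤ 1) : val L (σ x - x) < 1 := by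
  rw [lt_one_iff_le_exp]
  simpa using mem_ramificationGroup_iff.1 hσ x hx

instance ramificationGroup_normal (i : ℕ) : (ramificationGroup K L i).Normal where
  conj_mem σ hσ τ := by
    rw [mem_ramificationGroup_iff] at hσ ⊢
    intro x hx
    have := hσ (τ⁻¹ x) (by rwa [val_algEquiv])
    rw [← val_algEquiv τ] at this
    rw [map_sub, ← AlgEquiv.mul_apply, ← AlgEquiv.mul_apply, ← AlgEquiv.mul_apply, mul_inv_cancel,
      AlgEquiv.one_apply] at this
    exact this

/-- Every residue class is represented by an element fixed by the inertia group. -/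
theorem exists_fixed_val_sub_lt_one (K : Type*) [Field K] [Algebra K L] [FiniteDimensional K L]
    {x : L} (hx : val L x ≤ 1) :
    ∃ y : L, val L y ≤ 1 ∧ val L (x - y) < 1 ∧ ∀ σ ∈ ramificationGroup K L 0, σ y = y := by
  obtain ⟨y, hy, hyx, hyc⟩ := exists_pow_card_eq_self hx
  refine ⟨y, hy, by rwa [(val L).map_sub_swap], fun σ hσ => ?_⟩
  -- Inertia preserves the residue class, and a class contains only one Teichmüller representative.
  exact eq_of_pow_card_eq_self hy (by rwa [val_algEquiv]) hyc (by rw [← map_pow, hyc])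
    (val_sub_lt_one_of_mem_inertia hσ hy)

theorem exists_eq_add_mul {π : L} (hπ : val L π = exp (-1)) (K : Type*) [Field K] [Algebra K L]
    [FiniteDimensional K L] {x : L} (hx : val L x ≤ 1) :
    ∃ a z : L, val L a ≤ 1 ∧ (∀ σ ∈ ramificationGroup K L 0, σ a = a) ∧ val L z ≤ 1 ∧
      x = a + π * z := by
  obtain ⟨a, ha, hxa, hfix⟩ := exists_fixed_val_sub_lt_one K hx
  refine ⟨a, (x - a) * π ^ (-1 : ℤ), ha, hfix, ?_, ?_⟩
  · rw [← exp_zero, val_mul_zpow_le_iff hπ]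
    simpa using lt_one_iff_le_exp.1 hxa
  · rw [zpow_neg_one]
    field_simp [ne_zero_of_val_eq hπ]
    ring

/-- The position of `σ` in the ramification filtration is detected on a uniformizer. -/
theorem mem_ramificationGroup_succ {π : L} (hπ : val L π = exp (-1)) {i : ℕ} {σ : Gal(L/K)}
    (hσ : σ ∈ ramificationGroup K L i) (h : val L (σ π - π) ≤ exp (-(i + 2 : ℤ))) :
    σ ∈ ramificationGroup K L (i + 1) := by
  have h0 := ramificationGroup_anti (Nat.zero_le i) hσ
  rw [mem_ramificationGroup_iff] at hσ ⊢
  intro x hx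
  obtain ⟨a, z, ha, hfix, hz, rfl⟩ := exists_eq_add_mul hπ K hx
  -- The inertia-fixed part a does not move, so only the displacement of π and that of z, weighted
  -- by π, remain.
  have : σ (a + π * z) - (a + π * z) = (σ π - π) * σ z + π * (σ z - z) := by
    rw [map_add, hfix σ h0, map_mul]; ring
  rw [this]
  refine (val L).map_add_le ?_ ?_
  · rw [map_mul, val_algEquiv]
    refine (mul_le_of_le_one_right' hz).trans (h.trans ?_)
    rw [exp_le_exp]; push_cast; lia
  · rw [map_mul, hπ]
    refine (mul_le_mul_right (hσ z hz) _).trans ?_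
    rw [← exp_add, exp_le_exp]; push_cast; lia

theorem val_sub_le_of_mem_ramificationGroup_one {σ : Gal(L/K)}
    (hσ : σ ∈ ramificationGroup K L 1) {x : L} (hx : val L x ≤ exp (-2)) :
    val L (σ x - x) ≤ exp (-3) := by
  obtain ⟨π, hπ⟩ := exists_val_eq_exp_neg_one L
  rw [mem_ramificationGroup_iff] at hσ
  obtain ⟨y, rfl⟩ : ∃ y, x = π * y := ⟨π⁻¹ * x, by simp [ne_zero_of_val_eq hπ]⟩
  have hy : val L y ≤ exp (-1) := by
    rw [map_mul, hπ, show (-2 : ℤ) = -1 + -1 by rfl, exp_add] at hx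
    exact le_of_mul_le_mul_left hx exp_pos
  have h1 : (exp (-1) : WithZero (Multiplicative ℤ)) ≤ 1 := by
    rw [← exp_zero, exp_le_exp]; lia
  have : σ (π * y) - π * y = (σ π - π) * σ y + π * (σ y - y) := by
    rw [map_mul]; ring
  rw [this]
  refine (val L).map_add_le ?_ ?_
  · rw [map_mul, val_algEquiv, show (-3 : ℤ) = -(1 + 1) + -1 by rfl, exp_add]
    exact mul_le_mul' (by simpa using hσ π (hπ.trans_le h1)) hy
  · rw [map_mul, hπ, show (-3 : ℤ) = -1 + -(1 + 1) by rfl, exp_add]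
    exact mul_le_mul_right (by simpa using hσ y (hy.trans h1)) _

end Extension

/-! ### Wild inertia has exponent p, and its complement has order prime to p. -/

section ResidueCharacteristic

variable {K L : Type*} [Field K] [Field L] [ValuativeRel L] [TopologicalSpace L]
  [IsNonarchimedeanLocalField L] [Algebra K L] [FiniteDimensional K L]
  {p : ℕ} [Fact p.Prime] [CharP 𝓀[L] p]

theorem val_natCast_lt_one_iff {m : ℕ} : val L (m : L) < 1 ↔ p ∣ m := by
  rw [← CharP.cast_eq_zero_iff 𝓀[L] p, ← map_natCast (IsLocalRing.residue 𝒪[L]),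
    IsLocalRing.residue_eq_zero_iff, ← val_lt_one_iff]
  simp

theorem val_sub_one_lt_one_of_pow {x : L} {r : ℕ} (hx : val L x ≤ 1)
    (h : val L (x ^ p ^ r - 1) < 1) : val L (x - 1) < 1 := by
  lift x to 𝒪[L] using val_le_one_iff.1 hx
  have h' : x ^ p ^ r - 1 ∈ 𝓂[L] := val_lt_one_iff.1 (by simpa using h)
  have : x - 1 ∈ 𝓂[L] := by
    rw [← IsLocalRing.residue_eq_zero_iff] at h' ⊢
    rw [map_sub, map_pow, map_one, ← one_pow (p ^ r), ← sub_pow_char_pow] at h'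
    simpa using eq_zero_of_pow_eq_zero h'
  simpa using val_lt_one_iff.2 this

/-- In a weakly ramified extension the wild inertia group has exponent `p`. -/
theorem pow_eq_one_of_isWeaklyRamified (hweak : IsWeaklyRamified K L) {σ : Gal(L/K)}
    (hσ : σ ∈ ramificationGroup K L 1) : σ ^ p = 1 := by
  rw [← Subgroup.mem_bot, ← hweak, mem_ramificationGroup_iff]
  intro x hx
  have hδ := mem_ramificationGroup_iff.1 hσ x hx
  set δ := σ x - x with hδ_def
  have hδ2 : val L δ ≤ exp (-2) := by simpa using hδ
  have hσδ := val_sub_le_of_mem_ramificationGroup_one hσ hδ2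
  -- Modulo 𝔓_L^3, σ translates x by δ, since δ ∈ 𝔓_L^2 is itself fixed modulo 𝔓_L^3. After p steps
  -- the translation p δ also lies in 𝔓_L^3, so σ ^ p ∈ G_2.
  have key (k : ℕ) : val L ((σ ^ k) x - (x + k * δ)) ≤ exp (-3) := by
    induction k with
    | zero => simp
    | succ k ih =>
      have : (σ ^ (k + 1)) x - (x + (k + 1 : ℕ) * δ) =
          σ ((σ ^ k) x - (x + k * δ)) + k * (σ δ - δ) := by
        rw [pow_succ', AlgEquiv.mul_apply]
        simp only [map_sub, map_add, map_mul, map_natCast]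
        rw [hδ_def]
        push_cast
        ring
      rw [this]
      refine (val L).map_add_le (by rwa [val_algEquiv]) ?_
      rw [map_mul]
      exact (mul_le_of_le_one_left' (val_natCast_le_one k)).trans hσδ
  have hp : val L (p : L) ≤ exp (-1) :=
    lt_one_iff_le_exp.1 ((val_natCast_lt_one_iff (p := p)).2 dvd_rfl)
  have : (σ ^ p) x - x = ((σ ^ p) x - (x + p * δ)) + p * δ := by ring
  rw [this]
  refine ((val L).map_add_le (key p) ?_).trans_eq (by norm_num)
  rw [map_mul, show (-3 : ℤ) = -1 + -2 by rfl, exp_add]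
  exact mul_le_mul' hp hδ2

theorem isPGroup_of_isWeaklyRamified (hweak : IsWeaklyRamified K L) :
    IsPGroup p (ramificationGroup K L 1) := fun σ =>
  ⟨1, by rw [pow_one]; exact Subtype.ext (pow_eq_one_of_isWeaklyRamified hweak σ.2)⟩

/-- The action of an inertial automorphism on a uniformizer is multiplicative modulo `𝔓_L`. -/
theorem val_div_sub_pow_lt_one {π : L} {m : ℤ} (hπ : val L π = exp m) {σ : Gal(L/K)}
    (hσ : σ ∈ ramificationGroup K L 0) (k : ℕ) :
    val L ((σ ^ k) π / π - (σ π / π) ^ k) < 1 := by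
  have hπ0 := ne_zero_of_val_eq hπ
  induction k with
  | zero => simp [hπ0]
  | succ k ih =>
    have hu : val L (σ π / π) = 1 := by
      rw [map_div₀, val_algEquiv, div_self]; simpa
    have : (σ ^ (k + 1)) π / π - (σ π / π) ^ (k + 1) =
        (σ ((σ ^ k) π / π - (σ π / π) ^ k)) * (σ π / π) +
          (σ ((σ π / π) ^ k) - (σ π / π) ^ k) * (σ π / π) := by
      have hσπ : σ π ≠ 0 := by simpa
      rw [pow_succ' σ, AlgEquiv.mul_apply, map_sub, map_div₀ σ ((σ ^ k) π), sub_mul,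
        div_mul_div_cancel₀ hσπ]
      ring
    rw [this]
    refine (val L).map_add_lt ?_ ?_
    · rwa [map_mul, hu, mul_one, val_algEquiv]
    · rw [map_mul, hu, mul_one]
      exact val_sub_lt_one_of_mem_inertia hσ (by rw [map_pow, hu, one_pow])

/-- Tame inertia has order prime to the residue characteristic. -/
theorem not_dvd_card_of_disjoint {C : Subgroup Gal(L/K)} (hC : C ≤ ramificationGroup K L 0)
    (hdisj : ramificationGroup K L 1 ⊓ C = ⊥) : ¬ p ∣ Nat.card C := by
  intro hdvd
  obtain ⟨σ, hord⟩ := exists_prime_orderOf_dvd_card' p hdvd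
  obtain ⟨π, hπ⟩ := exists_val_eq_exp_neg_one L
  have hπ0 := ne_zero_of_val_eq hπ
  have hu : val L ((σ : Gal(L/K)) π / π) = 1 := by
    rw [map_div₀, val_algEquiv, div_self]; simpa
  have hpow : (σ : Gal(L/K)) ^ p = 1 := by
    rw [← hord, ← Subgroup.coe_pow, pow_orderOf_eq_one]; rfl
  have h1 := val_div_sub_pow_lt_one hπ (hC σ.2) p
  rw [hpow, AlgEquiv.one_apply, div_self hπ0, (val L).map_sub_swap] at h1
  -- For σ of order p, the residue of σ π / π has p-th power 1, hence is 1 by injectivity of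
  -- Frobenius; so σ is wild.
  have h2 := val_sub_one_lt_one_of_pow (p := p) (r := 1) hu.le (by rwa [pow_one])
  have h3 : (σ : Gal(L/K)) ∈ ramificationGroup K L 1 := by
    refine mem_ramificationGroup_succ hπ (hC σ.2) ?_
    have : (σ : Gal(L/K)) π - π = ((σ : Gal(L/K)) π / π - 1) * π := by field_simp
    rw [this, map_mul, hπ]
    refine (mul_le_mul_left (lt_one_iff_le_exp.1 h2) _).trans ?_
    rw [← exp_add, exp_le_exp]; norm_num
  have h4 : (σ : Gal(L/K)) ∈ (⊥ : Subgroup Gal(L/K)) := hdisj ▸ ⟨h3, σ.2⟩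
  have h5 : σ = 1 := Subtype.ext (Subgroup.mem_bot.1 h4)
  rw [h5, orderOf_one] at hord
  exact (Fact.out : p.Prime).one_lt.ne hord

end ResidueCharacteristic

end WeakRam

namespace WeakRam

open WithZero IsNonarchimedeanLocalField

/-! ### Traces over the unramified complement U. -/

section UnramifiedTrace

variable {K L : Type*} [Field K] [Field L] [ValuativeRel L] [TopologicalSpace L]
  [IsNonarchimedeanLocalField L] [Algebra K L]

/-- The character of the multiplicative monoid of `𝒪_L` given by an automorphism of `L`
followed by reduction. -/
noncomputable def residueChar (σ : Gal(L/K)) : 𝒪[L] →* 𝓀[L] where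
  toFun x := IsLocalRing.residue 𝒪[L]
    ⟨σ x, val_le_one_iff.1 ((val_algEquiv σ _).trans_le (val_coe_le_one x))⟩
  map_one' := by
    rw [← map_one (IsLocalRing.residue 𝒪[L])]; congr 1; exact Subtype.ext (map_one σ)
  map_mul' x y := by
    rw [← map_mul]; congr 1; exact Subtype.ext (map_mul σ (x : L) y)

variable [FiniteDimensional K L]

theorem inv_mul_mem_of_residueChar_eq {σ τ : Gal(L/K)} (h : residueChar σ = residueChar τ) :
    σ⁻¹ * τ ∈ ramificationGroup K L 0 := by
  rw [mem_ramificationGroup_iff]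
  intro x hx
  have h1 := DFunLike.congr_fun h ⟨x, val_le_one_iff.1 hx⟩
  have h2 : val L (τ x - σ x) < 1 := by
    have h3 := sub_eq_zero.2 h1.symm
    simp only [residueChar, MonoidHom.coe_mk, OneHom.coe_mk] at h3
    rw [← map_sub, IsLocalRing.residue_eq_zero_iff, ← val_lt_one_iff] at h3
    exact h3
  have h4 : (σ⁻¹ * τ) x - x = σ⁻¹ (τ x - σ x) := by
    rw [map_sub, ← AlgEquiv.mul_apply, ← AlgEquiv.mul_apply, inv_mul_cancel, AlgEquiv.one_apply]
  rw [h4, val_algEquiv]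
  simpa using lt_one_iff_le_exp.1 h2

/-- Distinct elements of U act differently on the residue field, so Dedekind's independence of
characters yields a twist y for which the U-trace of y z keeps the order of z. Taking y fixed by
inertia makes descent to K possible. -/
theorem exists_val_sum_eq (U : Subgroup Gal(L/K)) [Fintype U] (hU : ramificationGroup K L 0 ⊓ U = ⊥) (z : L) :
    ∃ y : L, val L y ≤ 1 ∧ (∀ σ ∈ ramificationGroup K L 0, σ y = y) ∧
      val L (∑ u : U, (u : Gal(L/K)) (y * z)) = val L z := by
  rcases eq_or_ne z 0 with rfl | hz
  · exact ⟨0, by simp⟩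
  have hm (u : U) : val L ((u : Gal(L/K)) z / z) ≤ 1 := by
    rw [map_div₀, val_algEquiv, div_self (by simpa)]
  have hli : LinearIndependent 𝓀[L] fun u : U => (residueChar (u : Gal(L/K)) : 𝒪[L] → 𝓀[L]) :=
    (linearIndependent_monoidHom 𝒪[L] 𝓀[L]).comp (fun u : U => residueChar (u : Gal(L/K)))
      fun u u' h => by
        have h1 : (u : Gal(L/K))⁻¹ * u' ∈ (⊥ : Subgroup Gal(L/K)) :=
          hU ▸ ⟨inv_mul_mem_of_residueChar_eq h, U.mul_mem (U.inv_mem u.2) u'.2⟩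
        exact Subtype.ext (inv_mul_eq_one.1 (Subgroup.mem_bot.1 h1))
  rw [Fintype.linearIndependent_iff] at hli
  let m (u : U) : 𝓀[L] := IsLocalRing.residue 𝒪[L] ⟨_, val_le_one_iff.1 (hm u)⟩
  -- The combination of characters is nontrivial: its coefficient at u = 1 is the residue of z / z =
  -- 1.
  obtain ⟨x, hx⟩ : ∃ x, (∑ u, m u • (residueChar (u : Gal(L/K)) : 𝒪[L] → 𝓀[L])) x ≠ 0 := by
    by_contra! h
    have h1 := hli m (funext h) 1
    rw [IsLocalRing.residue_eq_zero_iff, ← val_lt_one_iff] at h1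
    simp [hz] at h1
  obtain ⟨y, hy, hxy, hfix⟩ := exists_fixed_val_sub_lt_one K (val_coe_le_one x)
  refine ⟨y, hy, hfix, ?_⟩
  have h1 : ∑ u : U, (u : Gal(L/K)) (y * z) =
      (∑ u : U, (u : Gal(L/K)) y * ((u : Gal(L/K)) z / z)) * z := by
    rw [Finset.sum_mul]
    refine Finset.sum_congr rfl fun u _ => ?_
    rw [map_mul]; field_simp
  suffices h2 : val L (∑ u : U, (u : Gal(L/K)) y * ((u : Gal(L/K)) z / z)) = 1 by
    rw [h1, map_mul, h2, one_mul]
  refine le_antisymm ((val L).map_sum_le fun u _ => ?_) ?_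
  · rw [map_mul, val_algEquiv]
    exact mul_le_one' hy (hm u)
  · by_contra! hlt
    have h3 : val L (∑ u : U, (u : Gal(L/K)) x * ((u : Gal(L/K)) z / z)) < 1 := by
      have : ∑ u : U, (u : Gal(L/K)) x * ((u : Gal(L/K)) z / z) =
          ∑ u : U, (u : Gal(L/K)) y * ((u : Gal(L/K)) z / z) +
            ∑ u : U, (u : Gal(L/K)) (x - y) * ((u : Gal(L/K)) z / z) := by
        rw [← Finset.sum_add_distrib]
        refine Finset.sum_congr rfl fun u _ => ?_
        rw [map_sub]; ring
      rw [this]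
      refine (val L).map_add_lt hlt ((val L).map_sum_lt one_ne_zero fun u _ => ?_)
      rw [map_mul, val_algEquiv]
      exact mul_lt_one_of_lt_of_le hxy (hm u)
    refine hx ?_
    have h4 : (∑ u, m u • (residueChar (u : Gal(L/K)) : 𝒪[L] → 𝓀[L])) x =
        IsLocalRing.residue 𝒪[L] (∑ u : U,
          (⟨(u : Gal(L/K)) x,
            val_le_one_iff.1 ((val_algEquiv _ _).trans_le (val_coe_le_one x))⟩ : 𝒪[L]) *
          ⟨_, val_le_one_iff.1 (hm u)⟩) := by
      rw [Finset.sum_apply, map_sum]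
      refine Finset.sum_congr rfl fun u _ => ?_
      rw [map_mul, mul_comm]; rfl
    rw [h4, IsLocalRing.residue_eq_zero_iff, ← val_lt_one_iff]
    simpa using h3

end UnramifiedTrace

/-! ### Descent of partial traces and norms to fixed fields. -/

section FixedElements

variable {K L : Type*} [Field K] [Field L] [Algebra K L]

theorem apply_eq_of_mem_sup {H H' : Subgroup Gal(L/K)} {x : L} (h : ∀ σ ∈ H, σ x = x)
    (h' : ∀ σ ∈ H', σ x = x) : ∀ σ ∈ H ⊔ H', σ x = x := by
  have : H ⊔ H' ≤ MulAction.stabilizer Gal(L/K) x := sup_le h h'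
  exact this

theorem apply_sum_eq (U : Subgroup Gal(L/K)) [Fintype U] (x : L) :
    ∀ σ ∈ U, σ (∑ u : U, (u : Gal(L/K)) x) = ∑ u : U, (u : Gal(L/K)) x := by
  intro σ hσ
  rw [map_sum]
  exact Fintype.sum_equiv (Equiv.mulLeft (⟨σ, hσ⟩ : U)) _ _ fun u => rfl

theorem apply_prod_eq (U : Subgroup Gal(L/K)) [Fintype U] (x : L) :
    ∀ σ ∈ U, σ (∏ u : U, (u : Gal(L/K)) x) = ∏ u : U, (u : Gal(L/K)) x := by
  intro σ hσ
  rw [map_prod]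
  exact Fintype.prod_equiv (Equiv.mulLeft (⟨σ, hσ⟩ : U)) _ _ fun u => rfl

/-- Conjugation by σ permutes the factors. Thus the norm over the normal factor of a semi-direct
product, taken of an element fixed by the complement, is fixed by the whole product. -/
theorem apply_prod_eq_of_conj {U : Subgroup Gal(L/K)} [Fintype U] {x : L} {σ : Gal(L/K)}
    (hx : σ x = x) (h1 : ∀ u ∈ U, σ * u * σ⁻¹ ∈ U) (h2 : ∀ u ∈ U, σ⁻¹ * u * σ ∈ U) :
    σ (∏ u : U, (u : Gal(L/K)) x) = ∏ u : U, (u : Gal(L/K)) x := by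
  rw [map_prod]
  refine Fintype.prod_equiv ⟨fun u => ⟨_, h1 u u.2⟩, fun u => ⟨_, h2 u u.2⟩,
    fun u => Subtype.ext (by simp [mul_assoc]), fun u => Subtype.ext (by simp [mul_assoc])⟩ _ _
    fun u => ?_
  have hx' : σ⁻¹ x = x := by
    conv_lhs => rw [← hx]
    rw [← AlgEquiv.mul_apply, inv_mul_cancel, AlgEquiv.one_apply]
  simp [AlgEquiv.mul_apply, hx']

theorem apply_mem_fixed_of_normal {N : Subgroup Gal(L/K)} [hN : N.Normal] {x : L}
    (hx : ∀ σ ∈ N, σ x = x) (τ : Gal(L/K)) : ∀ σ ∈ N, σ (τ x) = τ x := by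
  intro σ hσ
  have h := hx _ (hN.conj_mem σ hσ τ⁻¹)
  rw [inv_inv, AlgEquiv.mul_apply, AlgEquiv.mul_apply] at h
  have h' := congrArg τ h
  rwa [← AlgEquiv.mul_apply τ τ⁻¹, mul_inv_cancel, AlgEquiv.one_apply] at h'

theorem val_prod_apply [ValuativeRel L] [TopologicalSpace L] [IsNonarchimedeanLocalField L]
    (U : Subgroup Gal(L/K)) [Fintype U] (x : L) :
    val L (∏ u : U, (u : Gal(L/K)) x) = val L x ^ Nat.card U := by
  rw [map_prod]
  simp [val_algEquiv, Nat.card_eq_fintype_card]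

end FixedElements

/-! ### Fractional ideals as finitely generated 𝒪_K-modules, and Nakayama's lemma. -/

section Lattices

variable (K : Type*) {L : Type*} [Field K] [ValuativeRel K] [TopologicalSpace K]
  [IsNonarchimedeanLocalField K]
  [Field L] [ValuativeRel L] [TopologicalSpace L] [IsNonarchimedeanLocalField L]
  [Algebra K L] [ValuativeExtension K L]

theorem val_smul_le (r : 𝒪[K]) (x : L) : val L (r • x) ≤ val L x := by
  rw [Subring.smul_def, Algebra.smul_def, map_mul]
  exact mul_le_of_le_one_left' (val_algebraMap_le_one_iff.2 r.2)

variable (L) in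
/-- The fractional ideal `𝔓_L ^ n` as an `𝒪_K`-module. -/
noncomputable def primePowSubmodule (n : ℤ) : Submodule 𝒪[K] L where
  carrier := {x | val L x ≤ exp (-n)}
  add_mem' hx hy := (val L).map_add_le hx hy
  zero_mem' := by simp
  smul_mem' r x hx := (val_smul_le K r x).trans hx

theorem mem_primePowSubmodule {n : ℤ} {x : L} :
    x ∈ primePowSubmodule K L n ↔ val L x ≤ exp (-n) := Iff.rfl

variable {K}

theorem mem_maximalIdeal_of_val_lt_one {x : 𝒪[K]} (hx : val L (algebraMap K L x) < 1) :
    x ∈ 𝓂[K] := by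
  rw [IsLocalRing.mem_maximalIdeal]
  rintro ⟨u, rfl⟩
  exact hx.ne (val_algebraMap_unit u)

variable [FiniteDimensional K L] [IsGalois K L]

/-- Trace pairings with a suitably scaled K-basis are integral on 𝔓_L^n, which therefore lies in the
span of the correspondingly scaled dual basis; 𝒪_K is noetherian. -/
theorem primePowSubmodule_fg {πK : K} {e : ℤ} (he : 0 < e)
    (hπK : val L (algebraMap K L πK) = exp (-e)) (n : ℤ) : (primePowSubmodule K L n).FG := by
  classical
  let b := Module.finBasis K L
  have hπ0 : πK ≠ 0 := (map_ne_zero (algebraMap K L)).1 (ne_zero_of_val_eq hπK)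
  have hd (i) : ∃ d : K, d ≠ 0 ∧ val L (algebraMap K L d * b i) ≤ exp n := by
    obtain ⟨k, hk⟩ := exists_val_eq_exp (L := L) (b.ne_zero i)
    refine ⟨πK ^ (k - n).toNat, pow_ne_zero _ hπ0, ?_⟩
    rw [map_mul, map_pow, val_pow_of_eq hπK, hk, ← exp_add, exp_le_exp]
    nlinarith [Int.self_le_toNat (k - n)]
  choose d hd0 hd using hd
  have htr (i) {x : L} (hx : x ∈ primePowSubmodule K L n) :
      Algebra.trace K L (x * (algebraMap K L (d i) * b i)) ∈ 𝒪[K] := by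
    rw [← val_algebraMap_le_one_iff (L := L), trace_eq_sum_automorphisms]
    refine (val L).map_sum_le fun σ _ => ?_
    rw [val_algEquiv, map_mul, ← exp_zero, ← neg_add_cancel n, exp_add]
    exact mul_le_mul' hx (hd i)
  let b' := (Algebra.traceForm K L).dualBasis (traceForm_nondegenerate K L) b
  refine Submodule.FG.of_le (T := Submodule.span 𝒪[K] (Set.range fun i => (d i)⁻¹ • b' i))
    (Submodule.fg_span (Set.finite_range _)) fun x hx => ?_
  rw [← b'.sum_repr x]
  refine Submodule.sum_mem _ fun i _ => ?_
  have : b'.repr x i • b' i = (⟨_, htr i hx⟩ : 𝒪[K]) • (d i)⁻¹ • b' i := by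
    rw [Subring.smul_def, smul_smul, LinearMap.BilinForm.dualBasis_repr_apply,
      Algebra.traceForm_apply]
    congr 1
    have h1 : x * (algebraMap K L (d i) * b i) = d i • (x * b i) := by
      rw [Algebra.smul_def]; ring
    simp only [h1, map_smul, smul_eq_mul]
    field_simp [hd0 i]
  rw [this]
  exact Submodule.smul_mem _ _ (Submodule.subset_span ⟨i, rfl⟩)

/-- Nakayama's lemma for the fractional ideals of `L` over `𝒪_K`. -/
theorem mem_of_forall_exists_val_sub_le {πK : K} {e : ℤ} (he : 0 < e)
    (hπK : val L (algebraMap K L πK) = exp (-e)) (n : ℤ) (N : Submodule 𝒪[K] L)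
    (h : ∀ x, val L x ≤ exp (-n) → ∃ y ∈ N, val L (x - y) ≤ exp (-(n + e))) {x : L}
    (hx : val L x ≤ exp (-n)) : x ∈ N := by
  have hlt : val L (algebraMap K L πK) < 1 := by
    rw [hπK, ← exp_zero, exp_lt_exp]; lia
  have hmem : πK ∈ 𝒪[K] := val_algebraMap_le_one_iff.1 hlt.le
  refine Submodule.le_of_le_smul_of_le_jacobson_bot (I := 𝓂[K]) (primePowSubmodule_fg he hπK n)
    (IsLocalRing.maximalIdeal_le_jacobson _) (fun x hx => ?_) hx
  obtain ⟨y, hy, hxy⟩ := h x hx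
  have h0 := ne_zero_of_val_eq hπK
  rw [show x = y + (⟨πK, hmem⟩ : 𝒪[K]) • ((x - y) * algebraMap K L πK ^ (-1 : ℤ)) by
    rw [Subring.smul_def, Algebra.smul_def, zpow_neg_one]; field_simp; ring]
  refine Submodule.add_mem_sup hy (Submodule.smul_mem_smul
    (mem_maximalIdeal_of_val_lt_one (L := L) hlt) ?_)
  rw [mem_primePowSubmodule, val_mul_zpow_le_iff hπK]
  refine hxy.trans ?_
  rw [exp_le_exp]; lia

/-- `n ≤ e f`: the degree is bounded in terms of generators of the unramified part. -/
theorem card_le_card_mul {πK : K} {e : ℕ} (he : 0 < e)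
    (hπK : val L (algebraMap K L πK) = exp (-(e : ℤ))) {ι : Type*} [Fintype ι] (b : ι → L)
    (hb : ∀ x, val L x ≤ 1 → (∀ σ ∈ ramificationGroup K L 0, σ x = x) →
      x ∈ Submodule.span 𝒪[K] (Set.range b)) :
    Nat.card Gal(L/K) ≤ Fintype.card ι * e := by
  obtain ⟨π, hπ⟩ := exists_val_eq_exp_neg_one L
  -- Inertia-fixed digits times 1, π, …, π ^ (e - 1) exhaust 𝒪_L modulo π_K, so by Nakayama the `g
  -- j` generate 𝒪_L, and hence span L over K.
  let g : ι × Fin e → L := fun j => b j.1 * π ^ (j.2 : ℕ)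
  let N := Submodule.span 𝒪[K] (Set.range g)
  have hmul (i : Fin e) {a : L} (ha : a ∈ Submodule.span 𝒪[K] (Set.range b)) :
      a * π ^ (i : ℕ) ∈ N := by
    induction ha using Submodule.span_induction with
    | mem x hx =>
      obtain ⟨j, rfl⟩ := hx
      exact Submodule.subset_span ⟨(j, i), rfl⟩
    | zero => simp
    | add x y _ _ hx hy => rw [add_mul]; exact N.add_mem hx hy
    | smul r x _ hx => rw [smul_mul_assoc]; exact N.smul_mem r hx
  have happrox (m : ℕ) (hm : m ≤ e) {x : L} (hx : val L x ≤ 1) :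
      ∃ y ∈ N, val L (x - y) ≤ exp (-(m : ℤ)) := by
    induction m with
    | zero => exact ⟨0, N.zero_mem, by simpa⟩
    | succ m ih =>
      obtain ⟨y, hy, hxy⟩ := ih (by lia)
      have h1 : val L ((x - y) * π ^ (-(m : ℤ))) ≤ 1 := by
        rw [← exp_zero, val_mul_zpow_le_iff hπ]; simpa using hxy
      obtain ⟨a, ha, hxa, hfix⟩ := exists_fixed_val_sub_lt_one K h1
      refine ⟨y + a * π ^ m, N.add_mem hy (hmul ⟨m, hm⟩ (hb a ha hfix)), ?_⟩
      have h2 : x - (y + a * π ^ m) = ((x - y) * π ^ (-(m : ℤ)) - a) * π ^ (m : ℤ) := by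
        have := ne_zero_of_val_eq hπ
        rw [sub_mul, mul_assoc, ← zpow_add₀ this, neg_add_cancel, zpow_zero, zpow_natCast]; ring
      rw [h2, val_mul_zpow_le_iff hπ]
      refine (lt_one_iff_le_exp.1 hxa).trans ?_
      rw [exp_le_exp]; push_cast; lia
  have hO {x : L} (hx : val L x ≤ 1) : x ∈ N := by
    refine mem_of_forall_exists_val_sub_le (n := 0) (by exact_mod_cast he) hπK N
      (fun x hx => ?_) (by simpa)
    simpa using happrox e le_rfl (by simpa using hx)
  have htop : Submodule.span K (Set.range g) = ⊤ := by
    rw [eq_top_iff]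
    intro x _
    rcases eq_or_ne x 0 with rfl | hx
    · exact zero_mem _
    obtain ⟨k, hk⟩ := exists_val_eq_exp hx
    have hπ0 : πK ≠ 0 := (map_ne_zero (algebraMap K L)).1 (ne_zero_of_val_eq hπK)
    have h1 : val L (πK ^ k.toNat • x) ≤ 1 := by
      rw [Algebra.smul_def, map_pow, map_mul, val_pow_of_eq hπK, hk, ← exp_add, ← exp_zero,
        exp_le_exp]
      nlinarith [Int.self_le_toNat k]
    have h2 := Submodule.span_le_restrictScalars 𝒪[K] K _ (hO h1)
    rw [Submodule.restrictScalars_mem] at h2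
    exact (Submodule.smul_mem_iff _ (pow_ne_zero _ hπ0)).1 h2
  have h3 := finrank_range_le_card (R := K) g
  rw [Set.finrank, htop, finrank_top, ← IsGalois.card_aut_eq_finrank] at h3
  simpa using h3

end Lattices

end WeakRam

namespace WeakRam

open WithZero IsNonarchimedeanLocalField

/-! ### Euler's formula for power sums weighted by the derivative. -/

section Lagrange

variable {L : Type*} [Field L] [ValuativeRel L] [TopologicalSpace L]
  [IsNonarchimedeanLocalField L]

open Polynomial in
theorem val_coeff_nodal_lt_one {ι : Type*} (s : Finset ι) (v : ι → L)
    (hv : ∀ i, val L (v i) < 1) {j : ℕ} (hj : j < s.card) :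
    val L ((Lagrange.nodal s v).coeff j) < 1 := by
  let v' (i : ι) : 𝒪[L] := ⟨v i, val_le_one_iff.1 (hv i).le⟩
  have h1 : Lagrange.nodal s v = (Lagrange.nodal s v').map (𝒪[L]).subtype := by
    simp [Lagrange.nodal, Polynomial.map_prod, v']
  have h2 : (Lagrange.nodal s v').map (IsLocalRing.residue 𝒪[L]) = X ^ s.card := by
    have h3 (i : ι) : IsLocalRing.residue 𝒪[L] (v' i) = 0 := by
      rw [IsLocalRing.residue_eq_zero_iff, ← val_lt_one_iff]; exact hv i
    simp [Lagrange.nodal, Polynomial.map_prod, h3]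
  rw [h1, coeff_map]
  refine val_lt_one_iff.2 ?_
  rw [← IsLocalRing.residue_eq_zero_iff, ← coeff_map, h2, coeff_X_pow, if_neg hj.ne]

variable {ι : Type*} [Fintype ι] [DecidableEq ι] (v : ι → L)

/-- The sum is the coefficient of X ^ (|ι| - 1) in the Lagrange interpolant of X ^ k, which is X ^ k
itself in this range. -/
theorem sum_pow_div_prod_eq (hinj : Function.Injective v) {k : ℕ} (hk : k < Fintype.card ι) :
    ∑ i, v i ^ k / ∏ j ∈ Finset.univ.erase i, (v i - v j) =
      if k = Fintype.card ι - 1 then 1 else 0 := by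
  have h := Lagrange.coeff_eq_sum (s := Finset.univ) (v := v) hinj.injOn
    (P := Polynomial.X ^ k) (by simpa [Polynomial.degree_X_pow] using hk)
  simp only [Polynomial.eval_pow, Polynomial.eval_X, Polynomial.coeff_X_pow,
    Finset.card_univ] at h
  rw [← h]
  simp [eq_comm]

-- Every v i is a root of the monic nodal polynomial, whose lower coefficients lie in 𝔓_L. Beyond
-- the range of Euler's formula the sums thus satisfy a linear recurrence with coefficients in 𝔓_L.
open Polynomial in
theorem val_sum_pow_div_prod (hinj : Function.Injective v) (hv : ∀ i, val L (v i) < 1) (k : ℕ) :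
    val L (∑ i, v i ^ k / ∏ j ∈ Finset.univ.erase i, (v i - v j)) ≤ 1 ∧
      (Fintype.card ι ≤ k →
        val L (∑ i, v i ^ k / ∏ j ∈ Finset.univ.erase i, (v i - v j)) < 1) := by
  induction k using Nat.strong_induction_on with
  | _ k ih =>
    rcases lt_or_ge k (Fintype.card ι) with hk | hk
    · refine ⟨?_, fun h => absurd h (not_le.2 hk)⟩
      rw [sum_pow_div_prod_eq v hinj hk]
      split_ifs <;> simp
    · suffices h : val L (∑ i, v i ^ k / ∏ j ∈ Finset.univ.erase i, (v i - v j)) < 1 from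
        ⟨h.le, fun _ => h⟩
      obtain ⟨m, rfl⟩ := Nat.exists_eq_add_of_le hk
      set q := Fintype.card ι with hq
      have hroot (i : ι) : v i ^ q =
          -∑ j ∈ Finset.range q, (Lagrange.nodal Finset.univ v).coeff j * v i ^ j := by
        have h1 := Lagrange.eval_nodal_at_node (s := Finset.univ) (v := v) (Finset.mem_univ i)
        rw [eval_eq_sum_range, Lagrange.natDegree_nodal, Finset.card_univ, ← hq,
          Finset.sum_range_succ] at h1
        have h2 : (Lagrange.nodal Finset.univ v).coeff q = 1 := by
          have := Lagrange.nodal_monic (s := Finset.univ) (v := v)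
          rw [Monic, leadingCoeff, Lagrange.natDegree_nodal, Finset.card_univ] at this
          exact this
        rw [h2, one_mul] at h1
        linear_combination h1
      have hsum : ∑ i, v i ^ (q + m) / ∏ j ∈ Finset.univ.erase i, (v i - v j) =
          -∑ l ∈ Finset.range q, (Lagrange.nodal Finset.univ v).coeff l *
            ∑ i, v i ^ (l + m) / ∏ j ∈ Finset.univ.erase i, (v i - v j) := by
        simp_rw [Finset.mul_sum]
        rw [Finset.sum_comm, ← Finset.sum_neg_distrib]
        refine Finset.sum_congr rfl fun i _ => ?_
        rw [pow_add, hroot, neg_mul, neg_div, Finset.sum_mul, Finset.sum_div]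
        congr 1
        refine Finset.sum_congr rfl fun l _ => ?_
        rw [pow_add]; ring
      rw [hsum, Valuation.map_neg]
      refine (val L).map_sum_lt one_ne_zero fun l hl => ?_
      rw [Finset.mem_range] at hl
      rw [map_mul]
      exact mul_lt_one_of_lt_of_le (val_coeff_nodal_lt_one _ v hv (by simpa using hl))
        (ih (l + m) (by lia)).1

end Lagrange

/-! ### The different and the trace of wild inertia. -/

section WildTrace

variable {K L : Type*} [Field K] [Field L] [ValuativeRel L] [TopologicalSpace L]
  [IsNonarchimedeanLocalField L] [Algebra K L] [FiniteDimensional K L]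

/-- Order at least 2 is the definition of G_1; order 3 would put τ⁻¹σ in G_2 = 1. -/
theorem val_apply_sub_apply (hweak : IsWeaklyRamified K L) {π : L} (hπ : val L π = exp (-1))
    {σ τ : Gal(L/K)} (hσ : σ ∈ ramificationGroup K L 1) (hτ : τ ∈ ramificationGroup K L 1)
    (hne : σ ≠ τ) : val L (σ π - τ π) = exp (-2) := by
  have hστ := Subgroup.mul_mem _ (Subgroup.inv_mem _ hτ) hσ
  have h1 : σ π - τ π = τ ((τ⁻¹ * σ) π - π) := by
    rw [map_sub, ← AlgEquiv.mul_apply, mul_inv_cancel_left]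
  rw [h1, val_algEquiv]
  have hπ1 : val L π ≤ 1 := by rw [hπ, ← exp_zero, exp_le_exp]; lia
  refine le_antisymm (by simpa using mem_ramificationGroup_iff.1 hστ π hπ1) ?_
  by_contra! h
  have h2 := mem_ramificationGroup_succ hπ hστ (by
    refine (lt_exp_iff_le_exp.1 h).trans ?_
    norm_num)
  rw [show 1 + 1 = 2 from rfl, hweak, Subgroup.mem_bot, inv_mul_eq_one] at h2
  exact hne h2.symm

variable [Fintype (ramificationGroup K L 1)]

open Classical in
/-- The derivative of the minimal polynomial of a uniformizer over the fixed field of wild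
inertia. -/
noncomputable def wildDifferent (K : Type*) [Field K] [Algebra K L] [FiniteDimensional K L]
    [Fintype (ramificationGroup K L 1)] (π : L) : L :=
  ∏ τ ∈ Finset.univ.erase (1 : ramificationGroup K L 1), (π - (τ : Gal(L/K)) π)

theorem val_wildDifferent (hweak : IsWeaklyRamified K L) {π : L} (hπ : val L π = exp (-1)) :
    val L (wildDifferent K π) = exp (-2 * (Nat.card (ramificationGroup K L 1) - 1 : ℤ)) := by
  classical
  rw [wildDifferent, map_prod, Finset.prod_congr rfl (g := fun _ => exp (-2 : ℤ))]
  · rw [Finset.prod_const, Finset.card_erase_of_mem (Finset.mem_univ _), Finset.card_univ,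
      ← exp_nsmul, nsmul_eq_mul, Nat.card_eq_fintype_card, Nat.cast_sub Fintype.card_pos]
    congr 1; push_cast; ring
  · intro τ hτ
    have := val_apply_sub_apply hweak hπ (Subgroup.one_mem _) τ.2
      (fun h => Finset.ne_of_mem_erase hτ (Subtype.ext h.symm))
    rwa [AlgEquiv.one_apply] at this

open Classical in
theorem apply_wildDifferent (π : L) (σ : ramificationGroup K L 1) :
    (σ : Gal(L/K)) (wildDifferent K π) =
      ∏ τ ∈ Finset.univ.erase σ, ((σ : Gal(L/K)) π - (τ : Gal(L/K)) π) := by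
  rw [wildDifferent, map_prod]
  refine Finset.prod_bij (fun τ _ => σ * τ) (fun τ hτ => ?_) (fun _ _ _ _ h => mul_left_cancel h)
    (fun τ hτ => ⟨σ⁻¹ * τ, ?_, by simp⟩) (fun τ _ => by simp [AlgEquiv.mul_apply])
  · simpa using hτ
  · simpa [inv_mul_eq_one, eq_comm] using hτ

theorem injective_apply (hweak : IsWeaklyRamified K L) {π : L} (hπ : val L π = exp (-1)) :
    Function.Injective fun σ : ramificationGroup K L 1 => (σ : Gal(L/K)) π := by
  intro σ τ h
  by_contra hne
  have := val_apply_sub_apply hweak hπ σ.2 τ.2 fun h => hne (Subtype.ext h)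
  simp only at h
  rw [sub_eq_zero.2 h, map_zero] at this
  exact exp_ne_zero this.symm

/-- Inertia-fixed digits are peeled off z, each multiplying an Euler sum of exponent at least q =
|G_1|. The parameter m bounds the number of digits to peel: once k ≥ 2 q - 1, every summand already
lies in 𝔓_L. -/
theorem val_sum_pow_mul_div_wildDifferent (hweak : IsWeaklyRamified K L) {π : L}
    (hπ : val L π = exp (-1)) (m : ℕ) : ∀ (k : ℕ) (z : L),
    Nat.card (ramificationGroup K L 1) ≤ k →
    2 * Nat.card (ramificationGroup K L 1) ≤ k + m + 1 → val L z ≤ 1 →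
    val L (∑ σ : ramificationGroup K L 1, (σ : Gal(L/K)) (z * π ^ k / wildDifferent K π)) < 1 := by
  classical
  set q := Nat.card (ramificationGroup K L 1) with hq
  induction m with
  | zero =>
    intro k z hk hkm hz
    refine (val L).map_sum_lt one_ne_zero fun σ _ => ?_
    rw [val_algEquiv, map_div₀, map_mul, val_wildDifferent hweak hπ, val_pow_of_eq hπ,
      mul_div_assoc, ← exp_sub]
    rw [mul_comm]
    refine mul_lt_one_of_lt_of_le ?_ hz
    rw [← exp_zero, exp_lt_exp, ← hq]
    lia
  | succ m ih =>
    intro k z hk hkm hz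
    obtain ⟨a, y, ha, hfix, hy, rfl⟩ := exists_eq_add_mul hπ K hz
    have h1 : ∑ σ : ramificationGroup K L 1,
        (σ : Gal(L/K)) ((a + π * y) * π ^ k / wildDifferent K π) =
        a * ∑ σ : ramificationGroup K L 1, ((σ : Gal(L/K)) π) ^ k /
          ∏ τ ∈ Finset.univ.erase σ, ((σ : Gal(L/K)) π - (τ : Gal(L/K)) π) +
        ∑ σ : ramificationGroup K L 1,
          (σ : Gal(L/K)) (y * π ^ (k + 1) / wildDifferent K π) := by
      rw [Finset.mul_sum, ← Finset.sum_add_distrib]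
      refine Finset.sum_congr rfl fun σ _ => ?_
      rw [← apply_wildDifferent]
      have hσa : (σ : Gal(L/K)) a = a := hfix _ (ramificationGroup_anti zero_le_one σ.2)
      rw [map_div₀, map_div₀, map_mul, map_mul, map_add, hσa, map_mul, map_pow, map_pow]
      ring
    rw [h1]
    refine (val L).map_add_lt ?_ (ih (k + 1) y (by lia) (by lia) hy)
    rw [map_mul]
    rw [mul_comm]
    refine mul_lt_one_of_lt_of_le ((val_sum_pow_div_prod
      (fun σ : ramificationGroup K L 1 => (σ : Gal(L/K)) π) (injective_apply hweak hπ)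
      (fun σ => ?_) k).2 ?_) ha
    · rw [val_algEquiv, hπ, ← exp_zero, exp_lt_exp]; lia
    · rwa [← Nat.card_eq_fintype_card]

/-- The trace to the fixed field of wild inertia of an element of valuation `1 - |G_1|` is a
unit. -/
theorem val_sum_wild_eq_one (hweak : IsWeaklyRamified K L) {x : L}
    (hx : val L x = exp (Nat.card (ramificationGroup K L 1) - 1 : ℤ)) :
    val L (∑ σ : ramificationGroup K L 1, (σ : Gal(L/K)) x) = 1 := by
  classical
  obtain ⟨π, hπ⟩ := exists_val_eq_exp_neg_one L
  have hπ0 := ne_zero_of_val_eq hπ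
  have hδ := val_wildDifferent hweak hπ
  have hδ0 := ne_zero_of_val_eq hδ
  set q := Nat.card (ramificationGroup K L 1) with hq
  have hq0 : 0 < q := Nat.card_pos
  -- The different has order 2 (q - 1), so π ^ (q - 1) divided by it has order 1 - q and z is a
  -- unit. In the exponent q - 1 Euler's sum is 1, which leaves the leading digit of z.
  obtain ⟨z, hzx⟩ : ∃ z, x = z * π ^ (q - 1) / wildDifferent K π :=
    ⟨x * wildDifferent K π / π ^ (q - 1), by field_simp⟩
  have hz : val L z = 1 := by
    have h1 : z * π ^ (q - 1) = x * wildDifferent K π := by rw [hzx]; field_simp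
    have h2 := congrArg (val L) h1
    rw [map_mul, map_mul, val_pow_of_eq hπ, hδ, hx, ← exp_add,
      show (q - 1 : ℤ) + -2 * (q - 1) = (q - 1 : ℕ) * -1 by push_cast [hq0]; ring] at h2
    exact mul_right_cancel₀ exp_ne_zero (h2.trans (one_mul _).symm)
  obtain ⟨a, y, ha, hfix, hy, hzay⟩ := exists_eq_add_mul hπ K hz.le
  have hπy : val L (π * y) < 1 := by
    rw [map_mul]
    exact mul_lt_one_of_lt_of_le (by rw [hπ, ← exp_zero, exp_lt_exp]; lia) hy
  have ha1 : val L a = 1 := by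
    have : a = z - π * y := by rw [hzay]; ring
    rw [this, (val L).map_sub_eq_of_lt_left (by rwa [hz]), hz]
  have h1 : ∑ σ : ramificationGroup K L 1, (σ : Gal(L/K)) x =
      a * ∑ σ : ramificationGroup K L 1, ((σ : Gal(L/K)) π) ^ (q - 1) /
        ∏ τ ∈ Finset.univ.erase σ, ((σ : Gal(L/K)) π - (τ : Gal(L/K)) π) +
      ∑ σ : ramificationGroup K L 1,
        (σ : Gal(L/K)) (y * π ^ q / wildDifferent K π) := by
    rw [Finset.mul_sum, ← Finset.sum_add_distrib]
    refine Finset.sum_congr rfl fun σ _ => ?_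
    rw [← apply_wildDifferent, hzx, hzay]
    have hσa : (σ : Gal(L/K)) a = a := hfix _ (ramificationGroup_anti zero_le_one σ.2)
    have hpow : (σ : Gal(L/K)) π ^ q = (σ : Gal(L/K)) π ^ (q - 1) * (σ : Gal(L/K)) π := by
      rw [← pow_succ, Nat.sub_add_cancel hq0]
    rw [map_div₀, map_div₀, map_mul, map_mul, map_add, hσa, map_mul, map_pow, map_pow, hpow]
    ring
  have h2 := sum_pow_div_prod_eq (fun σ : ramificationGroup K L 1 => (σ : Gal(L/K)) π)
    (injective_apply hweak hπ) (k := q - 1) (by rw [← Nat.card_eq_fintype_card]; lia)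
  rw [if_pos (by rw [← Nat.card_eq_fintype_card])] at h2
  rw [h1, h2, mul_one, (val L).map_add_eq_of_lt_left, ha1]
  rw [ha1]
  exact val_sum_pow_mul_div_wildDifferent hweak hπ q q y le_rfl (by lia) hy

end WildTrace

/-! ### Wild conjugates as a basis of 𝔓_L^(1-q) modulo 𝔓_L. -/

section WildLattice

variable {K L : Type*} [Field K] [Field L] [ValuativeRel L] [TopologicalSpace L]
  [IsNonarchimedeanLocalField L] [Algebra K L] [FiniteDimensional K L]

/-- A system of representatives of the residue field fixed by inertia. -/
theorem exists_residue_section (K : Type*) [Field K] [Algebra K L] [FiniteDimensional K L] :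
    ∃ s : 𝓀[L] → L, (∀ c, val L (s c) ≤ 1) ∧
    (∀ c, ∀ σ ∈ ramificationGroup K L 0, σ (s c) = s c) ∧
    (∀ x : 𝒪[L], val L (x - s (IsLocalRing.residue 𝒪[L] x)) < 1) := by
  have h (c : 𝓀[L]) : ∃ y : 𝒪[L], IsLocalRing.residue 𝒪[L] y = c ∧
      ∀ σ ∈ ramificationGroup K L 0, σ (y : L) = y := by
    obtain ⟨x, rfl⟩ := IsLocalRing.residue_surjective c
    obtain ⟨y, hy, hxy, hfix⟩ := exists_fixed_val_sub_lt_one K (val_coe_le_one x)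
    refine ⟨⟨y, val_le_one_iff.1 hy⟩, ?_, hfix⟩
    rw [eq_comm, ← sub_eq_zero, ← map_sub, IsLocalRing.residue_eq_zero_iff, ← val_lt_one_iff]
    exact hxy
  choose s hs hfix using h
  refine ⟨fun c => s c, fun c => val_coe_le_one _, hfix, fun x => ?_⟩
  beta_reduce
  rw [← AddSubgroupClass.coe_sub, val_lt_one_iff, ← IsLocalRing.residue_eq_zero_iff, map_sub, hs,
    sub_self]

/-- The digits belong to the exponents 0, -1, …, 1 - m of π. For m = |G_1| there are as many digit
vectors as coefficient vectors indexed by G_1, as the counting argument for generation requires. -/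
theorem exists_expansion {s : 𝓀[L] → L}
    (hs : ∀ x : 𝒪[L], val L (x - s (IsLocalRing.residue 𝒪[L] x)) < 1) {π : L}
    (hπ : val L π = exp (-1)) (m : ℕ) : ∀ z : L, val L z ≤ exp (m - 1 : ℤ) →
    ∃ f : Fin m → 𝓀[L], val L (z - ∑ i, s (f i) * π ^ (-(i : ℤ))) < 1 := by
  induction m with
  | zero => exact fun z hz => ⟨Fin.elim0, by rw [lt_one_iff_le_exp]; simpa using hz⟩
  | succ m ih =>
    intro z hz
    have h1 : val L (z * π ^ (m : ℤ)) ≤ 1 := by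
      rw [← exp_zero, val_mul_zpow_le_iff hπ]
      refine hz.trans ?_
      rw [exp_le_exp]; push_cast; lia
    set c := IsLocalRing.residue 𝒪[L] ⟨_, val_le_one_iff.1 h1⟩
    have h2 := hs ⟨_, val_le_one_iff.1 h1⟩
    obtain ⟨f, hf⟩ := ih (z - s c * π ^ (-(m : ℤ))) (by
      have h3 : z - s c * π ^ (-(m : ℤ)) = (z * π ^ (m : ℤ) - s c) * π ^ (-(m : ℤ)) := by
        rw [sub_mul, mul_assoc, ← zpow_add₀ (ne_zero_of_val_eq hπ), add_neg_cancel, zpow_zero,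
          mul_one]
      rw [h3, val_mul_zpow_le_iff hπ]
      refine (lt_one_iff_le_exp.1 h2).trans ?_
      rw [exp_le_exp]; lia)
    refine ⟨Fin.snoc f c, ?_⟩
    rw [Fin.sum_univ_castSucc]
    simp only [Fin.snoc_castSucc, Fin.snoc_last, Fin.val_castSucc, Fin.val_last]
    rw [add_comm, ← sub_sub]
    exact hf

variable [Fintype (ramificationGroup K L 1)]

/-- The conjugates under wild inertia of an element of valuation `1 - |G_1|` are linearly
independent modulo `𝔓_L` over the residue field. -/
theorem val_coeff_lt_one_of_val_sum_lt_one {p : ℕ} [Fact p.Prime] [CharP 𝓀[L] p]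
    (hweak : IsWeaklyRamified K L)
    (hF : ∀ a : L, (∀ σ ∈ ramificationGroup K L 0, σ a = a) → val L a < 1 →
      val L a ≤ exp (-(Nat.card (ramificationGroup K L 1) : ℤ))) {x : L}
    (hx : val L x = exp (Nat.card (ramificationGroup K L 1) - 1 : ℤ))
    {a : ramificationGroup K L 1 → L} (ha : ∀ w, val L (a w) ≤ 1)
    (hfix : ∀ w, ∀ σ ∈ ramificationGroup K L 0, σ (a w) = a w)
    (hsum : val L (∑ w, a w * (w : Gal(L/K)) x) < 1) (w) : val L (a w) < 1 := by
  have htr := val_sum_wild_eq_one hweak hx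
  -- `V` consists of the residue vectors of the relations modulo 𝔓_L among the conjugates of x, with
  -- inertia-fixed coefficients. It is a finite p-group, stable under translation by G_1.
  let V : AddSubgroup (ramificationGroup K L 1 → 𝓀[L]) :=
    { carrier := {f | ∃ b : ramificationGroup K L 1 → 𝒪[L], (∀ w, ∀ σ ∈ ramificationGroup K L 0, σ (b w : L) = b w) ∧
        (∀ w, IsLocalRing.residue 𝒪[L] (b w) = f w) ∧
        val L (∑ w, (b w : L) * (w : Gal(L/K)) x) < 1}
      zero_mem' := ⟨0, by simp⟩
      add_mem' := by
        rintro f g ⟨b, hb1, hb2, hb3⟩ ⟨d, hd1, hd2, hd3⟩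
        refine ⟨b + d, fun w σ hσ => ?_, fun w => ?_, ?_⟩
        · simp [hb1 w σ hσ, hd1 w σ hσ]
        · simp [hb2, hd2]
        · simp only [Pi.add_apply, Subring.coe_add, add_mul, Finset.sum_add_distrib]
          exact (val L).map_add_lt hb3 hd3
      neg_mem' := by
        rintro f ⟨b, hb1, hb2, hb3⟩
        refine ⟨-b, fun w σ hσ => ?_, fun w => ?_, ?_⟩
        · simp [hb1 w σ hσ]
        · simp [hb2]
        · simpa using hb3 }
  have hact (g : ramificationGroup K L 1) (f : V) : (fun w => f.1 (g⁻¹ * w)) ∈ V := by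
    obtain ⟨f, b, hb1, hb2, hb3⟩ := f
    refine ⟨fun w => b (g⁻¹ * w), fun w => hb1 _, fun w => hb2 _, ?_⟩
    rw [← val_algEquiv (g : Gal(L/K)), map_sum] at hb3
    convert hb3 using 2
    refine Fintype.sum_equiv (Equiv.mulLeft g⁻¹) _ _ fun w => ?_
    simp only [Equiv.coe_mulLeft, map_mul]
    rw [hb1 _ _ (ramificationGroup_anti zero_le_one g.2), ← AlgEquiv.mul_apply]
    simp
  let : MulAction (ramificationGroup K L 1) V :=
    { smul g f := ⟨_, hact g f⟩
      one_smul f := Subtype.ext (funext fun w => by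
        change f.1 (1⁻¹ * w) = f.1 w; simp)
      mul_smul g h f := Subtype.ext (funext fun w => by
        change f.1 ((g * h)⁻¹ * w) = f.1 (h⁻¹ * (g⁻¹ * w)); simp [mul_assoc]) }
  have hsmul (g : ramificationGroup K L 1) (f : V) (w : ramificationGroup K L 1) : (g • f).1 w = f.1 (g⁻¹ * w) := rfl
  by_contra hw
  let a' (w : ramificationGroup K L 1) : 𝒪[L] := ⟨a w, val_le_one_iff.1 (ha w)⟩
  let f₀ : V := ⟨fun w => IsLocalRing.residue 𝒪[L] (a' w), a', hfix, fun _ => rfl, hsum⟩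
  have hf₀ : f₀ ≠ 0 := by
    intro h
    have h1 := congrFun (congrArg Subtype.val h) w
    have h2 : IsLocalRing.residue 𝒪[L] (a' w) = 0 := h1
    rw [IsLocalRing.residue_eq_zero_iff, ← val_lt_one_iff] at h2
    exact hw h2
  have := Fintype.ofFinite 𝓀[L]
  have hcard : p ∣ Nat.card V := by
    obtain ⟨n, -, hn⟩ := FiniteField.card 𝓀[L] p
    have h1 : Nat.card V ∣ p ^ ((n : ℕ) * Fintype.card (ramificationGroup K L 1)) := by
      rw [pow_mul, ← hn]
      have := AddSubgroup.card_addSubgroup_dvd_card V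
      rwa [Nat.card_fun, Nat.card_eq_fintype_card (α := 𝓀[L]),
        Nat.card_eq_fintype_card (α := ramificationGroup K L 1)] at this
    obtain ⟨j, -, hj⟩ := (Nat.dvd_prime_pow (Fact.out : p.Prime)).1 h1
    have h2 : 1 < Nat.card V := Finite.one_lt_card_iff_nontrivial.2 ⟨f₀, 0, hf₀⟩
    rw [hj] at h2 ⊢
    exact dvd_pow_self p fun h => by simp [h] at h2
  -- The number of fixed points of a p-group on V is divisible by p, so 0 is not the only one; being
  -- fixed by translations means being constant.
  obtain ⟨f, hf, hf0⟩ := (isPGroup_of_isWeaklyRamified (p := p)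
    hweak).exists_fixed_point_of_prime_dvd_card_of_fixed_point V hcard (a := 0)
    fun g => Subtype.ext (funext fun w => rfl)
  have hconst (w : ramificationGroup K L 1) : f.1 w = f.1 1 := by
    have h1 := congrArg (fun f : V => f.1 w) (hf w)
    simp only [hsmul, inv_mul_cancel] at h1
    exact h1.symm
  obtain ⟨f, b, hb1, hb2, hb3⟩ := f
  have hb0 : val L (b 1) = 1 := by
    refine le_antisymm (val_coe_le_one _) ?_
    by_contra! h
    rw [val_lt_one_iff, ← IsLocalRing.residue_eq_zero_iff, hb2] at h
    exact hf0 (Subtype.ext (funext fun w => ((hconst w).trans h).symm))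
  -- Congruent inertia-fixed coefficients differ by order at least q, which outweighs the order 1 -
  -- q of w x. The relation thus puts b 1 times the trace of x in 𝔓_L, though both are units.
  have hsub (w : ramificationGroup K L 1) : val L ((b w : L) - b 1) ≤ exp (-(Nat.card (ramificationGroup K L 1) : ℤ)) := by
    refine hF _ (fun σ hσ => by rw [map_sub, hb1 w σ hσ, hb1 1 σ hσ]) ?_
    rw [← AddSubgroupClass.coe_sub, val_lt_one_iff, ← IsLocalRing.residue_eq_zero_iff, map_sub, hb2, hb2,
      sub_eq_zero]
    exact hconst w
  have hlt : val L ((b 1 : L) * ∑ w : ramificationGroup K L 1, (w : Gal(L/K)) x) < 1 := by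
    have : (b 1 : L) * ∑ w : ramificationGroup K L 1, (w : Gal(L/K)) x =
        ∑ w, (b w : L) * (w : Gal(L/K)) x - ∑ w, ((b w : L) - b 1) * (w : Gal(L/K)) x := by
      rw [Finset.mul_sum, ← Finset.sum_sub_distrib]
      exact Finset.sum_congr rfl fun w _ => by ring
    rw [this]
    refine (val L).map_sub_lt hb3 ((val L).map_sum_lt one_ne_zero fun w _ => ?_)
    rw [map_mul, val_algEquiv, hx]
    refine (mul_le_mul_left (hsub w) _).trans_lt ?_
    rw [← exp_add, ← exp_zero, exp_lt_exp]; lia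
  rw [map_mul, hb0, htr, one_mul] at hlt
  exact lt_irrefl _ hlt

/-- Modulo `𝔓_L`, the conjugates under wild inertia of an element of valuation `1 - |G_1|`
generate all elements of at least that valuation. -/
theorem exists_val_sub_sum_lt_one (hweak : IsWeaklyRamified K L)
    (hF : ∀ a : L, (∀ σ ∈ ramificationGroup K L 0, σ a = a) → val L a < 1 →
      val L a ≤ exp (-(Nat.card (ramificationGroup K L 1) : ℤ))) {x : L}
    (hx : val L x = exp (Nat.card (ramificationGroup K L 1) - 1 : ℤ)) {z : L}
    (hz : val L z ≤ exp (Nat.card (ramificationGroup K L 1) - 1 : ℤ)) :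
    ∃ a : ramificationGroup K L 1 → L, (∀ w, val L (a w) ≤ 1) ∧
      (∀ w, ∀ σ ∈ ramificationGroup K L 0, σ (a w) = a w) ∧
      val L (z - ∑ w, a w * (w : Gal(L/K)) x) < 1 := by
  obtain ⟨p, hp⟩ := CharP.exists 𝓀[L]
  have : Fact p.Prime := ⟨(CharP.char_is_prime_or_zero 𝓀[L] p).resolve_right
    (CharP.char_ne_zero_of_finite 𝓀[L] p)⟩
  obtain ⟨π, hπ⟩ := exists_val_eq_exp_neg_one L
  obtain ⟨s, hs1, hs2, hs3⟩ := exists_residue_section (L := L) K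
  have hs4 {c d : 𝓀[L]} (h : val L (s c - s d) < 1) : c = d := by
    obtain ⟨x, rfl⟩ := IsLocalRing.residue_surjective c
    obtain ⟨y, rfl⟩ := IsLocalRing.residue_surjective d
    rw [← sub_eq_zero, ← map_sub, IsLocalRing.residue_eq_zero_iff, ← val_lt_one_iff]
    have h1 : (x : L) - y = (x - s (IsLocalRing.residue 𝒪[L] x)) +
        (s (IsLocalRing.residue 𝒪[L] x) - s (IsLocalRing.residue 𝒪[L] y)) -
        (y - s (IsLocalRing.residue 𝒪[L] y)) := by ring
    rw [AddSubgroupClass.coe_sub, h1]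
    exact (val L).map_sub_lt ((val L).map_add_lt (hs3 x) h) (hs3 y)
  have hmem (b : ramificationGroup K L 1 → 𝓀[L]) :
      val L (∑ w, s (b w) * (w : Gal(L/K)) x) ≤ exp (Nat.card (ramificationGroup K L 1) - 1 : ℤ) := by
    refine (val L).map_sum_le fun w _ => ?_
    rw [map_mul, val_algEquiv, hx]
    exact mul_le_of_le_one_left' (hs1 _)
  -- `g` sends a coefficient vector to the digits of the resulting combination of conjugates.
  -- Independence makes it injective, and equality of cardinalities makes it surjective.
  choose g hg using fun b => exists_expansion hs3 hπ (Nat.card (ramificationGroup K L 1)) _ (hmem b)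
  have hinj : Function.Injective g := by
    intro b d hbd
    have h1 : val L (∑ w, (s (b w) - s (d w)) * (w : Gal(L/K)) x) < 1 := by
      have h2 := (val L).map_sub_lt (hg b) (hg d)
      rw [hbd, sub_sub_sub_cancel_right, ← Finset.sum_sub_distrib] at h2
      simpa only [sub_mul] using h2
    have h3 := val_coeff_lt_one_of_val_sum_lt_one (p := p) hweak hF hx
      (fun w => (val L).map_sub_le (hs1 _) (hs1 _))
      (fun w σ hσ => by rw [map_sub, hs2 _ σ hσ, hs2 _ σ hσ]) h1
    exact funext fun w => hs4 (h3 w)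
  have hsurj : Function.Surjective g := by
    have := Fintype.ofFinite 𝓀[L]
    classical
    refine ((Fintype.bijective_iff_injective_and_card g).2 ⟨hinj, ?_⟩).2
    simp [Nat.card_eq_fintype_card]
  obtain ⟨f, hf⟩ := exists_expansion hs3 hπ (Nat.card (ramificationGroup K L 1)) z hz
  obtain ⟨b, rfl⟩ := hsurj f
  refine ⟨fun w => s (b w), fun w => hs1 _, fun w => hs2 _, ?_⟩
  beta_reduce
  have h2 := (val L).map_sub_lt hf (hg b)
  rwa [sub_sub_sub_cancel_right] at h2

end WildLattice

end WeakRam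

namespace WeakRam

open WithZero IsNonarchimedeanLocalField

/-! ### Free generators, spans of conjugates, and injectivity by dimension. -/

section FreeGenerator

variable {K E : Type*} [Field K] [ValuativeRel K] [Field E] [Algebra K E]

theorem asAlgebraHom_galRep_apply [Fintype Gal(E/K)] (r : MonoidAlgebra 𝒪[K] Gal(E/K)) (x : E) :
    (galRep K E).asAlgebraHom r x = ∑ g : Gal(E/K), r.coeff g • g x := by
  rw [Representation.asAlgebraHom_def, MonoidAlgebra.lift_apply]
  simp only [Finsupp.sum, LinearMap.coe_sum, Finset.sum_apply, LinearMap.smul_apply]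
  exact Finset.sum_subset (Finset.subset_univ _) fun g _ hg => by
    rw [Finsupp.notMem_support_iff.1 hg, zero_smul]

theorem range_asAlgebraHom_galRep [Fintype Gal(E/K)] (x : E) :
    Set.range (fun r : MonoidAlgebra 𝒪[K] Gal(E/K) => (galRep K E).asAlgebraHom r x) =
      Submodule.span 𝒪[K] (Set.range fun g : Gal(E/K) => g x) := by
  ext y
  rw [SetLike.mem_coe, Submodule.mem_span_range_iff_exists_fun, Set.mem_range]
  constructor
  · rintro ⟨r, rfl⟩
    exact ⟨r.coeff, (asAlgebraHom_galRep_apply r x).symm⟩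
  · rintro ⟨c, rfl⟩
    exact ⟨.ofCoeff (Finsupp.equivFunOnFinite.symm c), asAlgebraHom_galRep_apply _ x⟩

theorem injective_asAlgebraHom_galRep [FiniteDimensional K E] [IsGalois K E] {x : E}
    (hx : ⊤ ≤ Submodule.span K (Set.range fun g : Gal(E/K) => g x)) :
    Function.Injective
      (fun r : MonoidAlgebra 𝒪[K] Gal(E/K) => (galRep K E).asAlgebraHom r x) := by
  have hli : LinearIndependent K fun g : Gal(E/K) => g x :=
    linearIndependent_of_top_le_span_of_card_eq_finrank hx
      (by rw [← IsGalois.card_aut_eq_finrank, Nat.card_eq_fintype_card])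
  rw [Fintype.linearIndependent_iff] at hli
  intro r s hrs
  simp only [asAlgebraHom_galRep_apply] at hrs
  have h := hli (fun g => (r.coeff g : K) - s.coeff g) (by
    simp only [sub_smul, Finset.sum_sub_distrib]
    rw [sub_eq_zero]
    exact hrs)
  have hcoeff : r.coeff = s.coeff := Finsupp.ext fun g => Subtype.ext (sub_eq_zero.1 (h g))
  cases r; cases s; exact congrArg _ hcoeff

end FreeGenerator

/-! ### Orders of the uniformizers in a doubly split extension. -/

section DoublySplit

theorem IsSemidirect.card_mul_card_le {G : Type*} [Group G] [Finite G] {H N Q : Subgroup G}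
    (h : IsSemidirect H N Q) : Nat.card N * Nat.card Q ≤ Nat.card H := by
  rw [← Nat.card_prod]
  refine Nat.card_le_card_of_injective
    (fun x : N × Q => (⟨x.1 * x.2, H.mul_mem (h.left_le x.1.2) (h.right_le x.2.2)⟩ : H)) ?_
  rintro ⟨x, y⟩ ⟨x', y'⟩ hxy
  have h1 : (x : G) * y = x' * y' := congrArg Subtype.val hxy
  have h2 : (x' : G)⁻¹ * x = y' * (y : G)⁻¹ := by
    rw [inv_mul_eq_iff_eq_mul, ← mul_assoc, ← h1, mul_inv_cancel_right]
  have h3 : (x' : G)⁻¹ * x ∈ (⊥ : Subgroup G) := h.disjoint ▸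
    ⟨N.mul_mem (N.inv_mem x'.2) x.2, h2 ▸ Q.mul_mem y'.2 (Q.inv_mem y.2)⟩
  have h4 := Subgroup.mem_bot.1 h3
  have h5 := h2 ▸ h4
  exact Prod.ext (Subtype.ext (inv_mul_eq_one.1 h4).symm) (Subtype.ext (mul_inv_eq_one.1 h5).symm)

theorem IsSemidirect.conj_mem {G : Type*} [Group G] {H N Q : Subgroup G}
    (h : IsSemidirect H N Q) {x y : G} (hx : x ∈ N) (hy : y ∈ H) : y * x * y⁻¹ ∈ N := by
  have := h.normal.conj_mem ⟨x, h.left_le hx⟩ (by simpa [Subgroup.mem_subgroupOf]) ⟨y, hy⟩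
  simpa [Subgroup.mem_subgroupOf] using this

variable {K L : Type*} [Field K] [ValuativeRel K] [TopologicalSpace K]
  [IsNonarchimedeanLocalField K]
  [Field L] [ValuativeRel L] [TopologicalSpace L] [IsNonarchimedeanLocalField L]
  [Algebra K L] [ValuativeExtension K L] [FiniteDimensional K L] [IsGalois K L]

/-- Each automorphism of L^I lifts to L, and modulo inertia the lift can be taken in U. -/
theorem mem_span_of_isFreeGenerator {U : Subgroup Gal(L/K)}
    (hU : IsSemidirect ⊤ (ramificationGroup K L 0) U)
    {F : IntermediateField K L}
    (hF : F = IntermediateField.fixedField (ramificationGroup K L 0)) {β : F}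
    (hβ : IsFreeGenerator K (integers F : Set F) β) {x : L} (hx : val L x ≤ 1) (hfix : ∀ σ ∈ ramificationGroup K L 0, σ x = x) :
    x ∈ Submodule.span 𝒪[K] (Set.range fun u : U => (u : Gal(L/K)) (β : L)) := by
  have hmem (z : L) : z ∈ F ↔ ∀ σ ∈ ramificationGroup K L 0, σ z = z := by
    rw [hF, IntermediateField.mem_fixedField_iff]
  have := Fintype.ofFinite Gal(F/K)
  let y : F := ⟨x, (hmem x).2 hfix⟩
  have hy : y ∈ (integers F : Set F) := (mem_integers_iff F y).2 hx
  rw [← hβ.2, range_asAlgebraHom_galRep, SetLike.mem_coe,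
    Submodule.mem_span_range_iff_exists_fun] at hy
  obtain ⟨c, hc⟩ := hy
  have hxc : x = ∑ g : Gal(F/K), c g • ((g β : F) : L) := by
    have h1 : x = algebraMap F L (∑ g : Gal(F/K), c g • g β) := by rw [hc]; rfl
    rw [h1, map_sum]
    rfl
  rw [hxc]
  refine Submodule.sum_mem _ fun g _ => Submodule.smul_mem _ _ (Submodule.subset_span ?_)
  obtain ⟨i, hi, u, hu, hiu⟩ := hU.mul_eq (g.liftNormal L) (Subgroup.mem_top _)
  refine ⟨⟨u, hu⟩, ?_⟩
  have h1 : (i * u) (β : L) = ((g β : F) : L) := by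
    rw [hiu]; exact g.liftNormal_commutes L β
  have h2 := (hmem _).1 (g β).2 i⁻¹ (Subgroup.inv_mem _ hi)
  rw [← h1, ← AlgEquiv.mul_apply, inv_mul_cancel_left] at h2
  exact h2.trans h1

theorem IsFreeGenerator.val_le_one {F : IntermediateField K L} {β : F}
    (hβ : IsFreeGenerator K (integers F : Set F) β) : val L (β : L) ≤ 1 := by
  have h1 : (galRep K F).asAlgebraHom 1 β = β := by simp
  have h2 : β ∈ (integers F : Set F) := hβ.2 ▸ ⟨1, h1⟩
  exact (mem_integers_iff F β).1 h2

theorem val_le_of_isUniformizer_fixedField {H : Subgroup Gal(L/K)}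
    {ϖ : IntermediateField.fixedField H}
    (h : IsUniformizer (integers (IntermediateField.fixedField H)) ϖ) {z : L}
    (hz : ∀ σ ∈ H, σ z = z) (hlt : val L z < 1) : val L z ≤ val L (ϖ : L) :=
  h.val_le (algebraMap (IntermediateField.fixedField H) L)
    (fun x => mem_integers_iff _ x)
    (z := ⟨z, (IntermediateField.mem_fixedField_iff _ _).2 hz⟩) hlt

theorem exists_val_eq_of_isUniformizer_fixedField {H : Subgroup Gal(L/K)}
    {ϖ : IntermediateField.fixedField H}
    (h : IsUniformizer (integers (IntermediateField.fixedField H)) ϖ) :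
    ∃ s : ℕ, 0 < s ∧ val L (ϖ : L) = exp (-(s : ℤ)) := by
  have hlt : val L (ϖ : L) < 1 :=
    h.val_lt_one (algebraMap (IntermediateField.fixedField H) L) (fun x => mem_integers_iff _ x)
  obtain ⟨k, hk⟩ := exists_val_eq_exp (x := (ϖ : L)) (by
    simpa using h.ne_zero)
  rw [hk, ← exp_zero, exp_lt_exp] at hlt
  refine ⟨k.natAbs, by lia, ?_⟩
  rw [hk]; congr 1; lia

theorem val_le_of_isUniformizer_base {πK : K} (h : IsUniformizer 𝒪[K] πK) {z : L}
    (hz : ∀ σ : Gal(L/K), σ z = z) (hlt : val L z < 1) :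
    val L z ≤ val L (algebraMap K L πK) := by
  obtain ⟨y, rfl⟩ := (IsGalois.mem_range_algebraMap_iff_fixed z).2 hz
  exact h.val_le (algebraMap K L) (fun x => val_algebraMap_le_one_iff.symm) hlt

variable {C U T S : Subgroup Gal(L/K)}

/-- L^I/K is unramified: a twisted U-trace carries an inertia-fixed element into K without changing
its order. -/
theorem val_le_of_fixed_inertia (hsplit : IsDoublySplit K L C U T) {πK : K}
    (hπK : IsUniformizer 𝒪[K] πK) {a : L} (ha : ∀ σ ∈ ramificationGroup K L 0, σ a = a)
    (hlt : val L a < 1) : val L a ≤ val L (algebraMap K L πK) := by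
  classical
  obtain ⟨y, -, hfix, hval⟩ := exists_val_sum_eq U hsplit.inertia.disjoint a
  rw [← hval] at hlt ⊢
  refine val_le_of_isUniformizer_base hπK (fun σ => ?_) hlt
  obtain ⟨i, hi, u, hu, rfl⟩ := hsplit.inertia.mul_eq σ (Subgroup.mem_top _)
  rw [AlgEquiv.mul_apply, apply_sum_eq U _ u hu, map_sum]
  refine Finset.sum_congr rfl fun v _ => ?_
  exact apply_mem_fixed_of_normal (fun σ hσ => by rw [map_mul, hfix σ hσ, ha σ hσ]) _ i hi

/-- Let s and t be the orders of π_S and π_T. The norms over W and over C of a U-fixed uniformizer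
of L lie in L^S and L^T, giving s ≤ q and t ≤ c. Since π_K has order c s, the bound q c |U| ≤ |G| ≤
c s |U| gives q ≤ s. Finally the W-norm of π_T lies in K, so q t ≥ c q. -/
theorem val_uniformizers (hsplit : IsDoublySplit K L C U T)
    (hS : S = ramificationGroup K L 1 ⊔ U)
    {πT : IntermediateField.fixedField T}
    (hπT : IsUniformizer (integers (IntermediateField.fixedField T)) πT)
    {πS : IntermediateField.fixedField S}
    (hπS : IsUniformizer (integers (IntermediateField.fixedField S)) πS)
    {πK : K} (hπK : IsUniformizer 𝒪[K] πK)
    (hπSK : (πS : L) ^ Nat.card C = algebraMap K L πK)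
    {F : IntermediateField K L}
    (hF : F = IntermediateField.fixedField (ramificationGroup K L 0)) {β : F}
    (hβ : IsFreeGenerator K (integers F : Set F) β) :
    val L (πS : L) = exp (-(Nat.card (ramificationGroup K L 1) : ℤ)) ∧
      val L (πT : L) = exp (-(Nat.card C : ℤ)) := by
  classical
  set q := Nat.card (ramificationGroup K L 1) with hq
  set c := Nat.card C with hc
  have hq0 : 0 < q := Nat.card_pos
  have hc0 : 0 < c := Nat.card_pos
  obtain ⟨s, hs0, hs⟩ := exists_val_eq_of_isUniformizer_fixedField hπS
  obtain ⟨t, ht0, ht⟩ := exists_val_eq_of_isUniformizer_fixedField hπT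
  -- a uniformizer fixed by `U`
  obtain ⟨ϖ, hϖ, hϖU⟩ : ∃ ϖ : L, val L ϖ = exp (-1) ∧ ∀ u ∈ U, u ϖ = ϖ := by
    obtain ⟨π, hπ⟩ := exists_val_eq_exp_neg_one L
    obtain ⟨y, -, -, hy⟩ := exists_val_sum_eq U hsplit.inertia.disjoint π
    exact ⟨_, hy.trans hπ, apply_sum_eq U _⟩
  have hsq : s ≤ q := by
    have h1 := val_le_of_isUniformizer_fixedField hπS
      (z := ∏ w : ramificationGroup K L 1, (w : Gal(L/K)) ϖ) (hS ▸ apply_eq_of_mem_sup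
        (apply_prod_eq _ _) fun u hu => apply_prod_eq_of_conj (hϖU u hu)
          (fun w hw => (ramificationGroup_normal 1).conj_mem w hw u)
          (fun w hw => (ramificationGroup_normal 1).conj_mem' w hw u)) (by
        rw [val_prod_apply, hϖ, ← exp_nsmul, ← exp_zero, exp_lt_exp]
        rw [nsmul_eq_mul]; lia)
    rw [val_prod_apply, hϖ, ← exp_nsmul, hs, exp_le_exp, nsmul_eq_mul] at h1
    lia
  have hvalK : val L (algebraMap K L πK) = exp (-((c * s : ℕ) : ℤ)) := by
    rw [← hπSK, val_pow_of_eq hs]; congr 1; push_cast; ring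
  have hqs : q ≤ s := by
    have h1 := card_le_card_mul (Nat.mul_pos hc0 hs0) hvalK (fun u : U => (u : Gal(L/K)) (β : L))
      fun x hx hfix => mem_span_of_isFreeGenerator hsplit.inertia hF hβ hx hfix
    have h2 := hsplit.inertia.card_mul_card_le
    have h3 := hsplit.tame.card_mul_card_le
    rw [Subgroup.card_top] at h2
    rw [← Nat.card_eq_fintype_card] at h1
    have hU0 : 0 < Nat.card U := Nat.card_pos
    have h4 : q * c * Nat.card U ≤ (c * s) * Nat.card U :=
      (Nat.mul_le_mul_right _ h3).trans (h2.trans (h1.trans_eq (mul_comm _ _)))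
    have h5 := Nat.le_of_mul_le_mul_right h4 hU0
    exact Nat.le_of_mul_le_mul_left (by rwa [mul_comm q c] at h5) hc0
  obtain rfl : s = q := le_antisymm hsq hqs
  refine ⟨hs, ?_⟩
  have htc : t ≤ c := by
    have h1 := val_le_of_isUniformizer_fixedField hπT
      (z := ∏ w : C, (w : Gal(L/K)) ϖ) (fun σ hσ => by
        obtain ⟨x, hx, u, hu, rfl⟩ := hsplit.complement.mul_eq σ hσ
        have huT := hsplit.complement.right_le hu
        rw [AlgEquiv.mul_apply, apply_prod_eq_of_conj (hϖU u hu)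
          (fun w hw => hsplit.complement.conj_mem hw huT)
          (fun w hw => by simpa using hsplit.complement.conj_mem hw (T.inv_mem huT)),
          apply_prod_eq C _ x hx]) (by
        rw [val_prod_apply, hϖ, ← exp_nsmul, ← exp_zero, exp_lt_exp]
        rw [nsmul_eq_mul]; lia)
    rw [val_prod_apply, hϖ, ← exp_nsmul, ht, exp_le_exp, nsmul_eq_mul] at h1
    lia
  have hct : c ≤ t := by
    have h1 := val_le_of_isUniformizer_base hπK
      (z := ∏ w : ramificationGroup K L 1, (w : Gal(L/K)) (πT : L)) (fun σ => by
        obtain ⟨w, hw, u, hu, rfl⟩ := hsplit.wild.mul_eq σ (Subgroup.mem_top _)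
        rw [AlgEquiv.mul_apply, apply_prod_eq_of_conj
          ((IntermediateField.mem_fixedField_iff _ _).1 πT.2 u hu)
          (fun w hw => (ramificationGroup_normal 1).conj_mem w hw u)
          (fun w hw => (ramificationGroup_normal 1).conj_mem' w hw u),
          apply_prod_eq _ _ w hw]) (by
        rw [val_prod_apply, ht, ← exp_nsmul, ← exp_zero, exp_lt_exp, nsmul_eq_mul]
        nlinarith)
    rw [val_prod_apply, ht, ← exp_nsmul, hvalK, exp_le_exp, nsmul_eq_mul, mul_neg,
      neg_le_neg_iff, ← Nat.cast_mul, Nat.cast_le, mul_comm c] at h1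
    exact Nat.le_of_mul_le_mul_left h1 hs0
  rw [ht, le_antisymm htc hct]

end DoublySplit

/-! ### Roots of unity of order prime to p and character orthogonality. -/

section TameCharacter

variable {K L : Type*} [Field K] [Field L] [ValuativeRel L] [TopologicalSpace L]
  [IsNonarchimedeanLocalField L] [Algebra K L]

/-- If η ≠ 1, then 1 + η + … + η ^ (c - 1) = 0, but this sum reduces to c, which is a unit. -/
theorem eq_one_of_pow_eq_one_of_val_sub_one_lt {η : L} {c : ℕ} (hc : val L (c : L) = 1)
    (hη : η ^ c = 1) (h : val L (η - 1) < 1) : η = 1 := by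
  have hη1 : val L η ≤ 1 := by
    rw [← sub_add_cancel η 1]
    exact (val L).map_add_le h.le (by simp)
  lift η to 𝒪[L] using val_le_one_iff.1 hη1
  have hη' : η ^ c = 1 := Subtype.ext (by simpa using hη)
  have hres : IsLocalRing.residue 𝒪[L] η = 1 := by
    rw [← sub_eq_zero, ← map_one (IsLocalRing.residue 𝒪[L]), ← map_sub,
      IsLocalRing.residue_eq_zero_iff, ← val_lt_one_iff]
    simpa using h
  have key := geom_sum_mul η c
  rw [hη', sub_self, mul_eq_zero] at key
  rcases key with key | key
  · have h1 := congrArg (IsLocalRing.residue 𝒪[L]) key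
    simp only [map_sum, map_pow, hres, one_pow, Finset.sum_const, Finset.card_range,
      nsmul_eq_mul, mul_one, map_zero] at h1
    rw [← map_natCast (IsLocalRing.residue 𝒪[L]), IsLocalRing.residue_eq_zero_iff,
      ← val_lt_one_iff] at h1
    simp [hc] at h1
  · rw [sub_eq_zero] at key
    rw [key]; rfl

variable [FiniteDimensional K L]

/-- `σ ∈ I` with `σ ϖ / ϖ ≡ 1`, where `ϖ` has valuation a power of `p`, is wild. -/
theorem mem_ramificationGroup_one_of_apply_eq {p : ℕ} [Fact p.Prime] [CharP 𝓀[L] p] {r : ℕ}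
    {ϖ : L} (hϖ : val L ϖ = exp (-((p ^ r : ℕ) : ℤ))) {σ : Gal(L/K)}
    (hσ : σ ∈ ramificationGroup K L 0) (h : σ ϖ = ϖ) : σ ∈ ramificationGroup K L 1 := by
  obtain ⟨π, hπ⟩ := exists_val_eq_exp_neg_one L
  have hπ0 := ne_zero_of_val_eq hπ
  have hϖ0 := ne_zero_of_val_eq hϖ
  set v := ϖ / π ^ p ^ r with hv
  have hv1 : val L v = 1 := by
    rw [hv, map_div₀, hϖ, val_pow_of_eq hπ, mul_neg, mul_one, div_self exp_ne_zero]
  have hv0 : v ≠ 0 := by intro h; simp [h] at hv1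
  set u := σ π / π with hu
  have hu1 : val L u = 1 := by
    rw [hu, map_div₀, val_algEquiv, div_self]; simpa
  have hu0 : u ≠ 0 := by intro h; simp [h] at hu1
  -- Here ϖ = v π ^ p ^ r with v a unit, and inertia fixes v modulo 𝔓_L; hence u ^ p ^ r ≡ 1, and
  -- Frobenius gives u ≡ 1.
  have h1 : u ^ p ^ r * σ v = v := by
    have hσπ : σ π ≠ 0 := by simpa
    rw [hv, hu, map_div₀, map_pow, h, div_pow]
    field_simp
  have h2 : val L (u ^ p ^ r - 1) < 1 := by
    have h3 : (u ^ p ^ r - 1) * σ v = -(σ v - v) := by rw [sub_mul, h1]; ring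
    have h4 := val_sub_lt_one_of_mem_inertia hσ hv1.le
    rw [← Valuation.map_neg, ← h3, map_mul, val_algEquiv, hv1, mul_one] at h4
    exact h4
  have h5 := val_sub_one_lt_one_of_pow hu1.le h2
  refine mem_ramificationGroup_succ hπ hσ ?_
  have h6 : σ π - π = (u - 1) * π := by rw [hu]; field_simp
  rw [h6, map_mul, hπ]
  refine (mul_le_mul_left (lt_one_iff_le_exp.1 h5) _).trans ?_
  rw [← exp_add, exp_le_exp]; norm_num

/-- Orthogonality of the powers of a faithful character. -/
theorem sum_zpow_eq {C F : Type*} [Group C] [Fintype C] [Field F] (χ : C →* Fˣ)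
    (hχ : Function.Injective χ) (j : ℤ) :
    ∑ σ, ((χ σ ^ j : Fˣ) : F) = if (Nat.card C : ℤ) ∣ j then (Nat.card C : F) else 0 := by
  split_ifs with h
  · obtain ⟨k, rfl⟩ := h
    have h1 (σ : C) : χ σ ^ ((Nat.card C : ℤ) * k) = 1 := by
      rw [zpow_mul, zpow_natCast, ← map_pow, pow_card_eq_one', map_one, one_zpow]
    simp only [h1]
    simp [Nat.card_eq_fintype_card]
  · have := isCyclic_of_injective_ringHom ((Units.coeHom F).comp χ)
      (Units.val_injective.comp hχ)
    obtain ⟨g, hg⟩ := IsCyclic.exists_ofOrder_eq_natCard (α := C)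
    refine sum_hom_units_eq_zero ((Units.coeHom F).comp (χ ^ j)) fun h1 => h ?_
    have h2 := DFunLike.congr_fun h1 g
    have h3 : χ g ^ j = 1 := Units.ext h2
    rw [← map_zpow, map_eq_one_iff χ hχ] at h3
    rw [← hg]
    exact orderOf_dvd_iff_zpow_eq_one.2 h3

end TameCharacter

end WeakRam

namespace WeakRam

open WithZero IsNonarchimedeanLocalField

/-! ### The tame character of C on π_S and its isotypic components. -/

section Generator

variable {K L : Type*} [Field K] [Field L] [ValuativeRel L] [TopologicalSpace L]
  [IsNonarchimedeanLocalField L] [Algebra K L] [FiniteDimensional K L]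

/-- The quotient σ ϖ / ϖ is a c-th root of unity because ϖ ^ c ∈ K. As c is prime to p, inertia
fixes such a root, which makes χ multiplicative. An element of the kernel fixes ϖ, of p-power order,
so it is wild and lies in W ∩ C = 1. -/
theorem exists_tameCharacter (hweak : IsWeaklyRamified K L) {C : Subgroup Gal(L/K)}
    (hC : C ≤ ramificationGroup K L 0) (hdisj : ramificationGroup K L 1 ⊓ C = ⊥) {ϖ : L} {πK : K}
    (hϖ : val L ϖ = exp (-(Nat.card (ramificationGroup K L 1) : ℤ)))
    (hϖK : ϖ ^ Nat.card C = algebraMap K L πK) :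
    val L (Nat.card C : L) = 1 ∧ ∃ χ : C →* Lˣ, Function.Injective χ ∧
      (∀ σ : C, (σ : Gal(L/K)) ϖ = χ σ * ϖ) ∧
      ∀ σ : C, ∀ τ ∈ ramificationGroup K L 0, τ (χ σ : L) = χ σ := by
  obtain ⟨p, hp⟩ := CharP.exists 𝓀[L]
  have : Fact p.Prime := ⟨(CharP.char_is_prime_or_zero 𝓀[L] p).resolve_right
    (CharP.char_ne_zero_of_finite 𝓀[L] p)⟩
  obtain ⟨r, hr⟩ := (isPGroup_of_isWeaklyRamified (p := p) hweak).exists_card_eq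
  have hϖ0 := ne_zero_of_val_eq hϖ
  have hc : val L (Nat.card C : L) = 1 := by
    refine le_antisymm (val_natCast_le_one _) ?_
    by_contra! h
    exact not_dvd_card_of_disjoint (p := p) hC hdisj (val_natCast_lt_one_iff.1 h)
  refine ⟨hc, ?_⟩
  have hne (σ : C) : (σ : Gal(L/K)) ϖ / ϖ ≠ 0 := div_ne_zero (by simpa) hϖ0
  have hval (σ : C) : val L ((σ : Gal(L/K)) ϖ / ϖ) = 1 := by
    rw [map_div₀, val_algEquiv, div_self (by simpa)]
  have hpow (σ : C) : ((σ : Gal(L/K)) ϖ / ϖ) ^ Nat.card C = 1 := by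
    rw [div_pow, ← map_pow, hϖK, AlgEquiv.commutes, ← hϖK, div_self (pow_ne_zero _ hϖ0)]
  have hfix (σ : C) (τ : Gal(L/K)) (hτ : τ ∈ ramificationGroup K L 0) :
      τ ((σ : Gal(L/K)) ϖ / ϖ) = (σ : Gal(L/K)) ϖ / ϖ := by
    refine (div_eq_one_iff_eq (hne σ)).1 (eq_one_of_pow_eq_one_of_val_sub_one_lt hc ?_ ?_)
    · rw [div_pow, ← map_pow, hpow, map_one, div_one]
    · rw [div_sub_one (hne σ), map_div₀, hval, div_one]
      exact val_sub_lt_one_of_mem_inertia hτ (hval σ).le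
  let χ : C →* Lˣ :=
    { toFun σ := Units.mk0 _ (hne σ)
      map_one' := Units.ext (by simp [hϖ0])
      map_mul' σ τ := Units.ext (by
        have h1 := hfix τ σ (hC σ.2)
        have h2 : (σ : Gal(L/K)) ϖ ≠ 0 := by simpa
        rw [map_div₀] at h1
        simp only [Units.val_mk0, Units.val_mul, Subgroup.coe_mul, AlgEquiv.mul_apply]
        rw [← h1]
        field_simp) }
  refine ⟨χ, (injective_iff_map_eq_one χ).2 fun σ hσ => ?_, fun σ => ?_, hfix⟩
  · have h1 : (σ : Gal(L/K)) ϖ / ϖ = 1 := congrArg Units.val hσ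
    have h2 := mem_ramificationGroup_one_of_apply_eq (p := p) (r := r) (by rw [hϖ, hr]) (hC σ.2)
      ((div_eq_one_iff_eq hϖ0).1 h1)
    have h3 : (σ : Gal(L/K)) ∈ (⊥ : Subgroup Gal(L/K)) := hdisj ▸ ⟨h2, σ.2⟩
    exact Subtype.ext (Subgroup.mem_bot.1 h3)
  · change _ = (σ : Gal(L/K)) ϖ / ϖ * ϖ
    field_simp

/-- The isotypic components of `∑ u i ϖ ^ (m + i)` under a faithful tame character. -/
theorem sum_char_mul_apply {C : Subgroup Gal(L/K)} [Fintype C] {χ : C →* Lˣ}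
    (hχ : Function.Injective χ) {ϖ : L} (hσ : ∀ σ : C, (σ : Gal(L/K)) ϖ = χ σ * ϖ)
    (u : Fin (Nat.card C) → K) (m : ℤ) (i : Fin (Nat.card C)) (hϖ0 : ϖ ≠ 0) :
    ∑ σ : C, ((χ σ ^ (-(m + i : ℤ)) : Lˣ) : L) *
      (σ : Gal(L/K)) (ϖ ^ m * ∑ j, algebraMap K L (u j) * ϖ ^ (j : ℕ)) =
      Nat.card C * algebraMap K L (u i) * ϖ ^ (m + i : ℤ) := by
  have h1 (σ : C) : ((χ σ ^ (-(m + i : ℤ)) : Lˣ) : L) *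
      (σ : Gal(L/K)) (ϖ ^ m * ∑ j, algebraMap K L (u j) * ϖ ^ (j : ℕ)) =
      ∑ j : Fin (Nat.card C), ((χ σ ^ (j - i : ℤ) : Lˣ) : L) *
        (algebraMap K L (u j) * ϖ ^ (m + j : ℤ)) := by
    rw [Finset.mul_sum, map_sum, Finset.mul_sum]
    refine Finset.sum_congr rfl fun j _ => ?_
    have h2 : ϖ ^ m * (algebraMap K L (u j) * ϖ ^ (j : ℕ)) =
        algebraMap K L (u j) * ϖ ^ (m + j : ℤ) := by
      rw [zpow_add₀ hϖ0, zpow_natCast]; ring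
    have h3 : (j - i : ℤ) = -(m + i) + (m + j) := by ring
    rw [h2, map_mul, AlgEquiv.commutes, map_zpow₀, hσ, mul_zpow, h3, zpow_add, Units.val_mul,
      Units.val_zpow_eq_zpow_val, Units.val_zpow_eq_zpow_val]
    ring
  simp_rw [h1]
  -- As |j - i| < |C|, the character χ ^ (j - i) is trivial only for j = i.
  rw [Finset.sum_comm, Finset.sum_eq_single i]
  · rw [← Finset.sum_mul, sum_zpow_eq χ hχ]
    simp [mul_assoc]
  · intro j _ hji
    rw [← Finset.sum_mul, sum_zpow_eq χ hχ, if_neg, zero_mul]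
    intro hdvd
    refine hji (Fin.ext ?_)
    have h4 := j.2
    have h5 := i.2
    have h6 := Int.eq_zero_of_abs_lt_dvd hdvd (abs_lt.2 ⟨by omega, by omega⟩)
    omega
  · exact fun h => absurd (Finset.mem_univ i) h

end Generator

end WeakRam

/-! ### Assembly: the conjugates of ε span 𝔓_L^n. -/

open WeakRam WithZero in
theorem theorem4p1
    {K L : Type*}
    [Field K] [ValuativeRel K] [TopologicalSpace K] [IsNonarchimedeanLocalField K]
    [Field L] [ValuativeRel L] [TopologicalSpace L] [IsNonarchimedeanLocalField L]
    [Algebra K L] [ValuativeExtension K L] [FiniteDimensional K L] [IsGalois K L]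
    (hweak : WeakRam.IsWeaklyRamified K L)
    (I W C U T S : Subgroup Gal(L/K))
    (hI : I = WeakRam.ramificationGroup K L 0)
    (hW : W = WeakRam.ramificationGroup K L 1)
    (hsplit : WeakRam.IsDoublySplit K L C U T)
    (hS : S = W ⊔ U)
    (n : ℤ) (hn : n ≡ 1 [ZMOD (Nat.card W : ℤ)])
    (a b : ℤ) (hab : a * (Nat.card W : ℤ) + b * (Nat.card C : ℤ) = 1)
    (πT : IntermediateField.fixedField T)
    (hπT : WeakRam.IsUniformizer (WeakRam.integers (IntermediateField.fixedField T)) πT)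
    (πS : IntermediateField.fixedField S)
    (hπS : WeakRam.IsUniformizer (WeakRam.integers (IntermediateField.fixedField S)) πS)
    (πK : K) (hπK : WeakRam.IsUniformizer 𝒪[K] πK)
    (hπSK : (πS : L) ^ Nat.card C = algebraMap K L πK)
    (u : Fin (Nat.card C) → 𝒪[K]ˣ)
    (α : L) (hα : α = ∑ i, algebraMap K L (u i : 𝒪[K]) * (πS : L) ^ (i : ℕ))
    (β : IntermediateField.fixedField I)
    (hβ : WeakRam.IsFreeGenerator K
      (WeakRam.integers (IntermediateField.fixedField I) : Set (IntermediateField.fixedField I)) β) :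
    WeakRam.IsFreeGenerator K (WeakRam.primePow L n)
      ((πT : L) ^ (n * b) * (πS : L) ^ (n * a) * α * (β : L)) := by
  classical
  have hS' : S = ramificationGroup K L 1 ⊔ U := hW ▸ hS
  have hF : IntermediateField.fixedField I =
      IntermediateField.fixedField (ramificationGroup K L 0) := by rw [hI]
  obtain ⟨hvS, hvT⟩ := val_uniformizers hsplit hS' hπT hπS hπK hπSK hF hβ
  obtain ⟨hvC, χ, hχ, hχσ, hχfix⟩ := exists_tameCharacter hweak hsplit.tame.right_le
    hsplit.tame.disjoint hvS hπSK
  rw [hW] at hn hab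
  have hπT0 := ne_zero_of_val_eq hvT
  have hπS0 := ne_zero_of_val_eq hvS
  have hTfix (τ) (hτ : τ ∈ T) : τ (πT : L) = πT :=
    (IntermediateField.mem_fixedField_iff _ _).1 πT.2 τ hτ
  have hSfix (τ) (hτ : τ ∈ S) : τ (πS : L) = πS :=
    (IntermediateField.mem_fixedField_iff _ _).1 πS.2 τ hτ
  have hβfix (τ) (hτ : τ ∈ ramificationGroup K L 0) : τ (β : L) = β :=
    (IntermediateField.mem_fixedField_iff _ _).1 β.2 τ (hI ▸ hτ)
  have hCI := hsplit.tame.right_le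
  have hWI : ramificationGroup K L 1 ≤ ramificationGroup K L 0 :=
    ramificationGroup_anti zero_le_one
  have hWS : ramificationGroup K L 1 ≤ S := hS' ▸ le_sup_left
  have hUS : U ≤ S := hS' ▸ le_sup_right
  set q := Nat.card (ramificationGroup K L 1) with hq
  have hq0 : 0 < q := Nat.card_pos
  have hc0 : 0 < Nat.card C := Nat.card_pos
  have hvK : val L (algebraMap K L πK) = exp (-((Nat.card C * q : ℕ) : ℤ)) := by
    rw [← hπSK, val_pow_of_eq hvS]; congr 1; push_cast; ring
  set ε := (πT : L) ^ (n * b) * (πS : L) ^ (n * a) * α * (β : L) with hε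
  set γ := (πS : L) ^ (n * a) * α with hγ
  set N := Submodule.span 𝒪[K] (Set.range fun g : Gal(L/K) => g ε) with hN
  have hfixF (x : L) (hlt : val L x < 1) (hfix : ∀ σ ∈ ramificationGroup K L 0, σ x = x) :
      val L x ≤ exp (-(q : ℤ)) := by
    refine (val_le_of_fixed_inertia hsplit hπK hfix hlt).trans ?_
    rw [hvK, exp_le_exp, neg_le_neg_iff, Nat.cast_le]
    exact Nat.le_mul_of_pos_left q hc0
  have hWγ (w) (hw : w ∈ ramificationGroup K L 1) : w γ = γ := by
    rw [hγ, hα, map_mul, map_zpow₀, hSfix w (hWS hw), map_sum]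
    simp only [map_mul, map_pow, AlgEquiv.commutes, hSfix w (hWS hw)]
  have hUγ (v) (hv : v ∈ U) : v γ = γ := by
    rw [hγ, hα, map_mul, map_zpow₀, hSfix v (hUS hv), map_sum]
    simp only [map_mul, map_pow, AlgEquiv.commutes, hSfix v (hUS hv)]
  -- Under w σ v each factor of ε sees one component: σ v ∈ T fixes π_T; v fixes γ, and w fixes σ γ
  -- by normality of W; w σ ∈ I fixes v β by normality of I.
  have hmem₁ (w : ramificationGroup K L 1) (σ : C) (x : L) (hx : val L x ≤ 1)
      (hfix : ∀ τ ∈ ramificationGroup K L 0, τ x = x) :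
      (w : Gal(L/K)) ((πT : L) ^ (n * b)) * (σ : Gal(L/K)) γ * x ∈ N := by
    have hspan := mem_span_of_isFreeGenerator hsplit.inertia hF hβ hx hfix
    clear hx hfix
    induction hspan using Submodule.span_induction with
    | mem y hy =>
      obtain ⟨v, rfl⟩ := hy
      refine Submodule.subset_span ⟨w * σ * v, ?_⟩
      have hT : (σ * v : Gal(L/K)) πT = πT := hTfix _ (T.mul_mem
        (hsplit.complement.left_le σ.2) (hsplit.complement.right_le v.2))
      have hγ' : (w : Gal(L/K)) ((σ : Gal(L/K)) γ) = (σ : Gal(L/K)) γ :=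
        apply_mem_fixed_of_normal hWγ _ w w.2
      have hβ' : (w * σ : Gal(L/K)) ((v : Gal(L/K)) (β : L)) = (v : Gal(L/K)) (β : L) :=
        apply_mem_fixed_of_normal hβfix _ _
          (Subgroup.mul_mem _ (hWI w.2) (hCI σ.2))
      have hε' : ε = (πT : L) ^ (n * b) * γ * (β : L) := by rw [hε, hγ]; ring
      simp only [AlgEquiv.mul_apply] at hT hβ' ⊢
      rw [hε', map_mul (v : Gal(L/K)), map_mul (σ : Gal(L/K)), map_mul (w : Gal(L/K)), hβ',
        map_mul (v : Gal(L/K)), hUγ v v.2, map_mul (σ : Gal(L/K)), map_mul (w : Gal(L/K)), hγ',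
        map_zpow₀ (v : Gal(L/K)), map_zpow₀ (σ : Gal(L/K)), hT]
    | zero => simp
    | add y z _ _ hy hz => rw [mul_add]; exact N.add_mem hy hz
    | smul r y _ hy => rw [mul_smul_comm]; exact N.smul_mem r hy
  -- The C-sum against χ ^ (-(n a + i)) extracts one power of π_S from γ. The character values and
  -- the G-fixed unit d are absorbed into the inertia-fixed coefficient.
  have hmem₂ (w : ramificationGroup K L 1) (i : Fin (Nat.card C)) (x : L) (hx : val L x ≤ 1)
      (hfix : ∀ τ ∈ ramificationGroup K L 0, τ x = x) :
      (w : Gal(L/K)) ((πT : L) ^ (n * b)) * (πS : L) ^ (n * a + i : ℤ) * x ∈ N := by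
    have hsum := sum_char_mul_apply hχ hχσ (fun i => ((u i : 𝒪[K]) : K)) (n * a) i hπS0
    rw [← hα, ← hγ] at hsum
    set d := (Nat.card C : L) * algebraMap K L (u i : 𝒪[K]) with hd
    have hd1 : val L d = 1 := by rw [hd, map_mul, hvC, val_algebraMap_unit, one_mul]
    have hd0 : d ≠ 0 := by intro h; simp [h] at hd1
    have hdfix (τ : Gal(L/K)) : τ d = d := by rw [hd, map_mul, map_natCast, AlgEquiv.commutes]
    have hχ1 (σ : C) : val L (χ σ : L) = 1 := by
      have h1 := congrArg (val L) (hχσ σ)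
      rw [val_algEquiv, map_mul] at h1
      exact (mul_eq_right₀ (by rw [hvS]; exact exp_ne_zero)).1 h1.symm
    have h1 : (w : Gal(L/K)) ((πT : L) ^ (n * b)) * (πS : L) ^ (n * a + i : ℤ) * x =
        ∑ σ : C, (w : Gal(L/K)) ((πT : L) ^ (n * b)) * (σ : Gal(L/K)) γ *
          (((χ σ ^ (-(n * a + i : ℤ)) : Lˣ) : L) * (x / d)) := by
      have h2 : (πS : L) ^ (n * a + i : ℤ) * x =
          (∑ σ : C, ((χ σ ^ (-(n * a + i : ℤ)) : Lˣ) : L) * (σ : Gal(L/K)) γ) * (x / d) := by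
        rw [hsum]; field_simp
      rw [mul_assoc, h2, Finset.sum_mul, Finset.mul_sum]
      exact Finset.sum_congr rfl fun σ _ => by ring
    rw [h1]
    refine N.sum_mem fun σ _ => hmem₁ w σ _ ?_ fun τ hτ => ?_
    · rw [map_mul, map_div₀, hd1, div_one, Units.val_zpow_eq_zpow_val, map_zpow₀, hχ1, one_zpow,
        one_mul]
      exact hx
    · rw [map_mul, map_div₀, hdfix, hfix τ hτ, Units.val_zpow_eq_zpow_val, map_zpow₀,
        hχfix σ τ hτ]
  obtain ⟨l, hl⟩ : ∃ l, n = 1 + q * l := by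
    obtain ⟨l, hl⟩ := hn.symm.dvd
    exact ⟨l, by rw [← hl]; ring⟩
  have hnb : n * b * (Nat.card C : ℤ) = 1 + q * l - q * (n * a) := by
    rw [← hl]; linear_combination n * hab
  -- Layer j uses the exponent n a + j of π_S and gains q orders; after c layers the gain is c q,
  -- the order of π_K.
  have happrox (j : ℕ) (hj : j ≤ Nat.card C) (x : L) (hx : val L x ≤ exp (-n)) :
      ∃ y ∈ N, val L (x - y) ≤ exp (-(n + j * q)) := by
    induction j with
    | zero => exact ⟨0, N.zero_mem, by simpa using hx⟩
    | succ j ih =>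
      obtain ⟨y, hy, hxy⟩ := ih (by lia)
      -- With n = 1 + q l, this m gives x₀ the order n b c - q m = 1 - q. Dividing the remainder, of
      -- order at least n + j q, by π_S ^ (m + n a + j) also leaves order at least 1 - q.
      set m : ℤ := l + 1 - n * a with hm
      set x₀ := (πT : L) ^ (n * b) * (πS : L) ^ (-m) with hx₀
      have hvx₀ : val L x₀ = exp (q - 1 : ℤ) := by
        rw [hx₀, map_mul, val_zpow_of_eq hvT, val_zpow_of_eq hvS, ← exp_add]
        congr 1
        rw [hm]; linear_combination -hnb
      have hwx₀ (w : ramificationGroup K L 1) : (w : Gal(L/K)) x₀ =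
          (w : Gal(L/K)) ((πT : L) ^ (n * b)) * (πS : L) ^ (-m) := by
        rw [hx₀, map_mul, map_zpow₀ (w : Gal(L/K)) (πS : L), hSfix _ (hWS w.2)]
      have hz : val L ((x - y) * (πS : L) ^ (-(m + (n * a + j)))) ≤ exp (q - 1 : ℤ) := by
        rw [val_mul_zpow_le_iff hvS]
        refine hxy.trans_eq ?_
        congr 1
        rw [hm]; linear_combination -hl
      obtain ⟨A, hA1, hAfix, hA⟩ := exists_val_sub_sum_lt_one hweak
        (fun x hfix hlt => hfixF x hlt hfix) hvx₀ hz
      refine ⟨y + ∑ w : ramificationGroup K L 1, (w : Gal(L/K)) ((πT : L) ^ (n * b)) *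
        (πS : L) ^ (n * a + j : ℤ) * A w, N.add_mem hy (N.sum_mem fun w _ =>
          hmem₂ w ⟨j, hj⟩ _ (hA1 w) (hAfix w)), ?_⟩
      have h1 : x - (y + ∑ w : ramificationGroup K L 1, (w : Gal(L/K)) ((πT : L) ^ (n * b)) *
          (πS : L) ^ (n * a + j : ℤ) * A w) =
          ((x - y) * (πS : L) ^ (-(m + (n * a + j))) - ∑ w, A w * (w : Gal(L/K)) x₀) *
            (πS : L) ^ (m + (n * a + j)) := by
        rw [sub_mul, mul_assoc, ← zpow_add₀ hπS0, neg_add_cancel, zpow_zero, mul_one, ← sub_sub,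
          Finset.sum_mul]
        congr 1
        refine Finset.sum_congr rfl fun w _ => ?_
        rw [hwx₀, zpow_add₀ hπS0 m, zpow_neg]
        field_simp
      rw [h1, val_mul_zpow_le_iff hvS]
      refine (lt_one_iff_le_exp.1 hA).trans_eq ?_
      congr 1
      rw [hm]; push_cast; linear_combination hl
  have hle (x : L) (hx : val L x ≤ exp (-n)) : x ∈ N := by
    refine mem_of_forall_exists_val_sub_le (by exact_mod_cast Nat.mul_pos hc0 hq0) hvK n N
      (fun x hx => ?_) hx
    simpa using happrox (Nat.card C) le_rfl x hx
  have hvε : val L ε ≤ exp (-n) := by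
    have h1 : val L α ≤ 1 := by
      rw [hα]
      refine (val L).map_sum_le fun i _ => ?_
      rw [map_mul, val_algebraMap_unit, one_mul, map_pow, hvS]
      exact pow_le_one₀ zero_le (by rw [← exp_zero, exp_le_exp]; lia)
    rw [hε, map_mul, map_mul, map_mul, val_zpow_of_eq hvT, val_zpow_of_eq hvS, ← exp_add]
    refine (mul_le_of_le_one_right' hβ.val_le_one).trans ((mul_le_of_le_one_right' h1).trans ?_)
    rw [exp_le_exp]
    exact (by linear_combination -n * hab : _ = -n).le
  refine ⟨injective_asAlgebraHom_galRep fun x _ => ?_, ?_⟩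
  · rcases eq_or_ne x 0 with rfl | hx0
    · exact zero_mem _
    obtain ⟨k, hk⟩ := exists_val_eq_exp hx0
    have hπK0 := hπK.ne_zero
    -- As x has order -k and π_K order at least 1, this power of π_K moves x into 𝔓_L^n; over K it
    -- can be divided out again.
    have h1 : val L (πK ^ (k + n).toNat • x) ≤ exp (-n) := by
      rw [Algebra.smul_def, map_pow, map_mul, val_pow_of_eq hvK, hk, ← exp_add, exp_le_exp]
      have h2 := Int.self_le_toNat (k + n)
      have h3 : (1 : ℤ) ≤ (Nat.card C * q : ℕ) := by exact_mod_cast Nat.mul_pos hc0 hq0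
      nlinarith [Int.natCast_nonneg (k + n).toNat]
    have h2 := Submodule.span_le_restrictScalars 𝒪[K] K _ (hle _ h1)
    rw [Submodule.restrictScalars_mem] at h2
    exact (Submodule.smul_mem_iff _ (pow_ne_zero _ hπK0)).1 h2
  · rw [range_asAlgebraHom_galRep]
    ext x
    rw [SetLike.mem_coe, mem_primePow_iff]
    refine ⟨fun hx => ?_, hle x⟩
    have h1 : N ≤ primePowSubmodule K L n := by
      rw [hN, Submodule.span_le]
      rintro _ ⟨g, rfl⟩
      exact (val_algEquiv g ε).trans_le hvε
    exact h1 hx
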